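/- Let $p\ge 1$ and let $a_n^{(0)}>0$, $b_n^{(0)}\in\mathbb R$ be $p$-periodic: $a^{(0)}_{n+p}=a^{(0)}_n$, $b^{(0)}_{n+p}=b^{(0)}_n$. Let $\{a_n,b_n\}_{n\ge1}$, with $a_n>0$ and $b_n\in\mathbb R$, be Jacobi parameters such that $$\lim_{n\to\infty}\bigl(|a_n-a_n^{(0)}|+|b_n-b_n^{(0)}|\bigr)=0,\qquad \sum_{n=1}^\infty\bigl(|a_{n+p}-a_n|+|b_{n+p}-b_n|\bigr)<\infty .$$ Let $p_n$ be the orthonormal polynomials, $p_{-1}=0$, $p_0=1$, $xp_n=a_{n+1}p_{n+1}+b_{n+1}p_n+a_np_{n-1}$, and let $\nu_n$ be the measure giving weight $1/n$ to each zero of $p_n$. Let $\Delta(E)$ be the discriminant of the periodic parameters, i.e. the trace of the one-period transfer matrix of $a^{(0)}_nu_{n+1}+(b^{(0)}_n-E)u_n+a^{(0)}_{n-1}u_{n-1}=0$ (with $a_0^{(0)}=a_p^{(0)}$). The bands are the closures $B_j$ of the connected components of $\{E\in\mathbb R:|\Delta(E)|<2\}$, and the interior of the bands is $\bigcup_j B_j^{\mathrm{int}}$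 (so all gaps, including closed ones, are removed). Then the $\nu_n$ converge weakly to a probability measure $\nu$ (the density of states). There is a real differentiable function $\gamma$ on the interior of the bands with $d\gamma/dE<0$ such that for every $E$ there the periodic equation has a nonzero (Floquet) solution with $u_{n+p}=e^{i\gamma(E)}u_n$ for all $n$. For every such $\gamma$ and every closed interval $[\alpha,\beta]$ contained in the interior of the bands: (i) on $[\alpha,\beta]$ the density of states is $$d\nu(E)=-\frac1{\pi p}\,\frac{d\gamma}{dE}\,dE ,$$ and the symmetric derivative $d\nu/dE$ of $\nu$ exists and equals $-\frac{1}{\pi p}\frac{d\gamma}{dE}$ at every point of $[\alpha,\beta]$; (ii) there is uniform clock behavior on $[\alpha,\beta]$: $d\nu/dE$ is continuous and nonvanishing on $[\alpha,\beta]$, and $$\lim_{n\to\infty}\ \sup\Bigl\{\bigl|\,n(E-E')-\bigl(\tfrac{d\nu}{dE}(x)\bigr)^{-1}\bigr| \;:\; E'<E \text{ successive zeros of } p_n \text{ in } [\alpha,\beta],\ E'\le x\le E\Bigr\}=0 .$$ -/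

import Mathlib

open Set Filter Topology MeasureTheory
open scoped BoundedContinuousFunction

noncomputable section

namespace JacobiClock

/-! Jacobi parameters are sequences `a b : ℕ → ℝ` whose relevant entries are those of index `≥ 1`. -/

/-- The orthonormal polynomials `p_n` with Jacobi parameters `a_n, b_n` (`n ≥ 1`):
`p_{-1} = 0`, `p_0 = 1`, `x p_n = a_{n+1} p_{n+1} + b_{n+1} p_n + a_n p_{n-1}`. -/
def orthoPoly (a b : ℕ → ℝ) : ℕ → Polynomial ℝ
  | 0 => 1
  | 1 => Polynomial.C (a 1)⁻¹ * (Polynomial.X - Polynomial.C (b 1))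
  | n + 2 => Polynomial.C (a (n + 2))⁻¹ *
      ((Polynomial.X - Polynomial.C (b (n + 2))) * orthoPoly a b (n + 1)
        - Polynomial.C (a (n + 1)) * orthoPoly a b n)

/-- The zero counting measure `ν_n`: weight `1/n` at each zero of `p_n`. -/
def zeroMeasure (a b : ℕ → ℝ) (n : ℕ) : Measure ℝ :=
  (n : ENNReal)⁻¹ • ((orthoPoly a b n).roots.map (fun x => Measure.dirac x)).sum

/-- The probability measure `ν` is the density of states: the weak limit of the `ν_n`. -/
def IsDensityOfStates (a b : ℕ → ℝ) (ν : Measure ℝ) : Prop :=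
  IsProbabilityMeasure ν ∧
    ∀ f : ℝ →ᵇ ℝ, Tendsto (fun n => ∫ x, f x ∂(zeroMeasure a b n)) atTop (𝓝 (∫ x, f x ∂ν))

/-- The symmetric derivative `dν/dE` exists at `E` and equals `d`. -/
def HasSymmDerivAt (ν : Measure ℝ) (d E : ℝ) : Prop :=
  Tendsto (fun h : ℝ => (ν (Ioo (E - h) (E + h))).toReal / (2 * h)) (𝓝[>] 0) (𝓝 d)

/-- `E' < E` are successive zeros of `p_n` in `[α, β]`. -/
def SuccessiveZeros (a b : ℕ → ℝ) (n : ℕ) (α β E' E : ℝ) : Prop :=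
  E' ∈ Icc α β ∧ E ∈ Icc α β ∧ E' < E ∧
    (orthoPoly a b n).IsRoot E' ∧ (orthoPoly a b n).IsRoot E ∧
    ∀ x ∈ Ioo E' E, ¬ (orthoPoly a b n).IsRoot x

/-- Uniform clock behavior on `[α, β]`, where `ν` is the density of states: `ρ = dν/dE` is
continuous and nonvanishing on `[α, β]`, and
`sup |n (E - E') - ρ(x)⁻¹| → 0`, the supremum being over all successive zeros `E' < E` of `p_n`
in `[α, β]` and all evaluation points `x` with `E' ≤ x ≤ E`. -/
def UniformClock (a b : ℕ → ℝ) (ν : Measure ℝ) (α β : ℝ) : Prop :=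
  ∃ ρ : ℝ → ℝ,
    (∀ E ∈ Icc α β, HasSymmDerivAt ν (ρ E) E) ∧
    ContinuousOn ρ (Icc α β) ∧
    (∀ E ∈ Icc α β, ρ E ≠ 0) ∧
    ∀ ε > 0, ∀ᶠ n : ℕ in atTop, ∀ E' E, SuccessiveZeros a b n α β E' E →
      ∀ x ∈ Icc E' E, |n * (E - E') - (ρ x)⁻¹| ≤ ε

/-- The transfer matrix: `(u_{n+1}, u_n) = T_n(E) (u_1, u_0)` for every solution `u` of
`a_n u_{n+1} + (b_n - E) u_n + a_{n-1} u_{n-1} = 0`, `n ≥ 1`. -/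
def transferMatrix (a b : ℕ → ℝ) (E : ℝ) : ℕ → Matrix (Fin 2) (Fin 2) ℝ
  | 0 => 1
  | n + 1 => !![(E - b (n + 1)) / a (n + 1), -(a n / a (n + 1)); 1, 0] * transferMatrix a b E n

/-- The discriminant of `p`-periodic Jacobi parameters. -/
def discriminant (a b : ℕ → ℝ) (p : ℕ) (E : ℝ) : ℝ :=
  (transferMatrix a b E p).trace

/-- The closed bands of `p`-periodic Jacobi parameters: the closures of the connected components of
`{E | -2 < Δ(E) < 2}`. (Two bands may touch in a point, which is then a closed gap.) -/
def bands (a b : ℕ → ℝ) (p : ℕ) : Set (Set ℝ) :=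
  {B | ∃ E, |discriminant a b p E| < 2 ∧
    B = closure (connectedComponentIn {x | |discriminant a b p x| < 2} E)}

/-- The interior of the bands, `⋃ⱼ int(Bⱼ)`; all gaps, the closed ones included, are removed. -/
def bandInterior (a b : ℕ → ℝ) (p : ℕ) : Set ℝ :=
  ⋃ B ∈ bands a b p, interior B

/-- `u` solves `a_n u_{n+1} + (b_n - E) u_n + a_{n-1} u_{n-1} = 0` for `n ≥ 1`. -/
def IsSolution (a b : ℕ → ℝ) (E : ℝ) (u : ℕ → ℂ) : Prop :=
  ∀ n : ℕ, (a (n + 1) : ℂ) * u (n + 2) + ((b (n + 1) : ℂ) - E) * u (n + 1) + (a n : ℂ) * u n = 0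

/-- `γ` is the (decreasing branch of the) Floquet phase of `p`-periodic Jacobi parameters: for every
`E` in the interior of the bands there is a nonzero solution with `u_{n+p} = e^{iγ(E)} u_n`, and
`dγ/dE` exists and is negative there. -/
structure IsFloquetPhase (a b : ℕ → ℝ) (p : ℕ) (γ : ℝ → ℝ) : Prop where
  floquet : ∀ E ∈ bandInterior a b p, ∃ u : ℕ → ℂ, u ≠ 0 ∧ IsSolution a b E u ∧
    ∀ n, u (n + p) = Complex.exp (Complex.I * (γ E : ℂ)) * u n
  differentiableAt : ∀ E ∈ bandInterior a b p, DifferentiableAt ℝ γ E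
  deriv_neg : ∀ E ∈ bandInterior a b p, deriv γ E < 0

end JacobiClock

end

namespace JacobiClock

open Polynomial

/-! ### The three-term recurrence in unimodular form -/

/-! The recurrence is written for the vector `(p_n, a_n p_{n-1})`, so that its one-step matrices
have determinant one. Fix a residue `r` modulo `p`. Passing from index `jp + r` to `(j+1)p + r`
applies a matrix `T_j(E)`, polynomial in `E`, which converges to a one-period matrix of the periodic
problem and has summable variation in `j`, uniformly on bounded sets of energies
(`blockPoly_asympPeriodic`). On a compact interval inside the bands `T_j` is eventually elliptic,
with eigenvalues `e^{±iθ_j}`, `θ_j = arccos (tr T_j / 2)`.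

Pair the vector with the left eigenvector `(l_j, 1)` of `T_j` to get a complex number `ζ_j`. One
period multiplies it by `e^{iθ_j}` up to a factor `1 + O(|l_{j+1} - l_j|)`. These errors are
summable, so `arg ζ_k` is `∑ θ_j + η_k` with `η_k` bounded and asymptotically equicontinuous
(`exists_phase_of_elliptic`, `PeriodicLimit.exists_phase`). Since `Im ζ_k` is a nonvanishing
multiple of `p_n`, `n = kp + r`, the zeros of `p_n` are the energies at which this phase is a
multiple of `π`.

Clock behavior: Christoffel–Darboux makes `a_n p_{n-1}` alternate in sign at successive zeros, so
the phase changes by exactly `π` between them (`abs_phase_sub_eq_pi`). The mean value theorem for `∑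
θ_j` and Cesàro averaging of the `θ_j'` give `k |θ'| (E - E') ≈ π`, where `θ = arccos (Δ / 2)`.
Boundedness of `η_k` first yields `E - E' = O(1/k)`; equicontinuity then makes the contribution of
`η_k` negligible (`PeriodicLimit.clock_residue`).

Density of states: the same phase bounds the number of zeros in an interval from below
(`PeriodicLimit.count`). The measure `|θ'| / (πp) dE` on the bands has total mass one, because `Δ`
has `p` distinct zeros, one in each band, and `θ` runs over an interval of length `π` on each
(`densityOfStates_univ`). Lower bounds on open sets therefore already give weak convergence.

Two facts about the periodic problem enter. `Δ' ≠ 0` where `|Δ| < 2`, because `Δ - c` is real-rooted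
for every `|c| < 2` (Green's identity) and Laguerre's inequality applies
(`discPoly_derivative_ne_zero`). And `Δ = 2 cos γ` for every Floquet phase, so a decreasing `γ` has
`γ' = -|θ'|` (`IsFloquetPhase.deriv_eq`). -/

/-- The second component of the unimodular solution vector: `q_0 = 0`, `q_{n+1} = a_{n+1} p_n`. -/
noncomputable def secondPoly (a b : ℕ → ℝ) : ℕ → ℝ[X]
  | 0 => 0
  | n + 1 => C (a (n + 1)) * orthoPoly a b n

lemma orthoPoly_succ (a b : ℕ → ℝ) (n : ℕ) :
    orthoPoly a b (n + 1) = C (a (n + 1))⁻¹ *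
      ((X - C (b (n + 1))) * orthoPoly a b n - secondPoly a b n) := by
  cases n with
  | zero => simp [orthoPoly, secondPoly]
  | succ n => simp [orthoPoly, secondPoly]

/-- The unimodular one-step matrix, polynomial in the energy. -/
noncomputable def stepPoly (s t : ℝ) : Matrix (Fin 2) (Fin 2) ℝ[X] :=
  !![C s⁻¹ * (X - C t), -C s⁻¹; C s, 0]

/-- The product of the one-step matrices with indices `n + 1, …, n + j`. -/
noncomputable def blockPoly (a b : ℕ → ℝ) (n : ℕ) : ℕ → Matrix (Fin 2) (Fin 2) ℝ[X]
  | 0 => 1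
  | j + 1 => stepPoly (a (n + j + 1)) (b (n + j + 1)) * blockPoly a b n j

lemma blockPoly_succ_zero (a b : ℕ → ℝ) (n j : ℕ) (i : Fin 2) :
    blockPoly a b n (j + 1) 0 i = C (a (n + j + 1))⁻¹ *
      ((X - C (b (n + j + 1))) * blockPoly a b n j 0 i - blockPoly a b n j 1 i) := by
  simp [blockPoly, stepPoly, Matrix.mul_apply, Fin.sum_univ_two]
  ring

lemma blockPoly_succ_one (a b : ℕ → ℝ) (n j : ℕ) (i : Fin 2) :
    blockPoly a b n (j + 1) 1 i = C (a (n + j + 1)) * blockPoly a b n j 0 i := by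
  simp [blockPoly, stepPoly, Matrix.mul_apply, Fin.sum_univ_two]

lemma blockPoly_det {a b : ℕ → ℝ} (ha : ∀ n, 1 ≤ n → 0 < a n) (n j : ℕ) :
    (blockPoly a b n j).det = 1 := by
  induction j with
  | zero => simp [blockPoly]
  | succ j ih =>
    have h : C (a (n + j + 1))⁻¹ * C (a (n + j + 1)) = (1 : ℝ[X]) := by
      rw [← C_mul, inv_mul_cancel₀ (ha _ (by omega)).ne', C_1]
    rw [blockPoly, Matrix.det_mul, ih]
    simp [stepPoly, Matrix.det_fin_two, h]

lemma blockPoly_shift (a b : ℕ → ℝ) (n j : ℕ) :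
    blockPoly a b n (j + 1) =
      blockPoly a b (n + 1) j * stepPoly (a (n + 1)) (b (n + 1)) := by
  induction j with
  | zero => simp [blockPoly]
  | succ j ih =>
    rw [blockPoly, ih, blockPoly, ← Matrix.mul_assoc, show n + 1 + j = n + (j + 1) by omega]

/-- Moving the starting point by one permutes the factors cyclically, so all residue classes share
one discriminant. -/
lemma blockPoly_trace_periodic {a b : ℕ → ℝ} {p : ℕ} (hp : 1 ≤ p)
    (ha : ∀ n, a (n + p) = a n) (hb : ∀ n, b (n + p) = b n) (n : ℕ) :
    (blockPoly a b n p).trace = (blockPoly a b 0 p).trace := by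
  induction n with
  | zero => rfl
  | succ n ih =>
    obtain ⟨j, rfl⟩ : ∃ j, p = j + 1 := ⟨p - 1, by omega⟩
    rw [← ih, blockPoly_shift a b n, Matrix.trace_mul_comm, blockPoly,
      show n + 1 + j + 1 = n + 1 + (j + 1) by omega, ha, hb]

lemma orthoPoly_add (a b : ℕ → ℝ) (n j : ℕ) :
    orthoPoly a b (n + j) = blockPoly a b n j 0 0 * orthoPoly a b n +
        blockPoly a b n j 0 1 * secondPoly a b n ∧
      secondPoly a b (n + j) = blockPoly a b n j 1 0 * orthoPoly a b n +
        blockPoly a b n j 1 1 * secondPoly a b n := by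
  induction j with
  | zero => simp [blockPoly]
  | succ j ih =>
    rw [← add_assoc, orthoPoly_succ, secondPoly, ih.1, ih.2]
    simp only [blockPoly_succ_zero, blockPoly_succ_one]
    constructor <;> ring

/-- The lower row lags one degree behind, so the leading coefficient of the trace comes from the
upper left entry alone. -/
lemma blockPoly_natDegree (a b : ℕ → ℝ) (n j : ℕ) (i : Fin 2) :
    (blockPoly a b n j 0 i).natDegree ≤ j ∧ (blockPoly a b n (j + 1) 1 i).natDegree ≤ j ∧
      (blockPoly a b n j 1 i).natDegree ≤ j := by
  have key : ∀ j, (blockPoly a b n j 0 i).natDegree ≤ j ∧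
      (blockPoly a b n j 1 i).natDegree ≤ j := by
    intro j
    induction j with
    | zero => simp only [blockPoly, Matrix.one_apply]; split_ifs <;> simp
    | succ j ih =>
      rw [blockPoly_succ_zero, blockPoly_succ_one]
      refine ⟨(natDegree_C_mul_le _ _).trans ?_, (natDegree_C_mul_le _ _).trans (by omega)⟩
      refine (natDegree_sub_le _ _).trans (max_le (natDegree_mul_le.trans ?_) (by omega))
      rw [natDegree_X_sub_C]; omega
  refine ⟨(key j).1, ?_, (key j).2⟩
  rw [blockPoly_succ_one]
  exact (natDegree_C_mul_le _ _).trans (key j).1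

lemma blockPoly_coeff_pos {a : ℕ → ℝ} (b : ℕ → ℝ) (ha : ∀ n, 1 ≤ n → 0 < a n) (n j : ℕ) :
    0 < (blockPoly a b n j 0 0).coeff j := by
  induction j with
  | zero => simp [blockPoly]
  | succ j ih =>
    rw [blockPoly_succ_zero, coeff_C_mul, coeff_sub, sub_mul, coeff_sub, coeff_X_mul, coeff_C_mul,
      coeff_eq_zero_of_natDegree_lt (lt_of_le_of_lt (blockPoly_natDegree a b n j 0).1
        (Nat.lt_succ_self j)),
      coeff_eq_zero_of_natDegree_lt (lt_of_le_of_lt (blockPoly_natDegree a b n j 0).2.2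
        (Nat.lt_succ_self j))]
    have := ha (n + j + 1) (by omega)
    simp only [mul_zero, sub_zero]
    positivity

/-- The discriminant as a polynomial. -/
noncomputable def discPoly (a b : ℕ → ℝ) (p : ℕ) : ℝ[X] := (blockPoly a b 0 p).trace

lemma discPoly_natDegree {a : ℕ → ℝ} (b : ℕ → ℝ) {p : ℕ} (hp : 1 ≤ p)
    (ha : ∀ n, 1 ≤ n → 0 < a n) :
    (discPoly a b p).natDegree = p := by
  obtain ⟨j, rfl⟩ : ∃ j, p = j + 1 := ⟨p - 1, by omega⟩
  have h1 := (blockPoly_natDegree a b 0 (j + 1) 0).1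
  have h2 := (blockPoly_natDegree a b 0 j 1).2.1
  have h3 := blockPoly_coeff_pos b ha 0 (j + 1)
  refine le_antisymm ?_ ?_
  · rw [discPoly, Matrix.trace_fin_two]
    exact (natDegree_add_le _ _).trans (max_le h1 (by omega))
  · apply le_natDegree_of_ne_zero
    rw [discPoly, Matrix.trace_fin_two, coeff_add,
      coeff_eq_zero_of_natDegree_lt (lt_of_le_of_lt h2 (Nat.lt_succ_self j)), add_zero]
    exact h3.ne'

/-- The two matrices differ by the change of variables `diag(1, a_n)` on the left and `diag(1,
a_0)⁻¹` on the right; over a full period this is a conjugation. -/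
lemma transferMatrix_eq {a : ℕ → ℝ} (b : ℕ → ℝ) (ha : ∀ n, 0 < a n) (E : ℝ) (n : ℕ) :
    transferMatrix a b E n 0 0 = (blockPoly a b 0 n 0 0).eval E ∧
    transferMatrix a b E n 0 1 = (blockPoly a b 0 n 0 1).eval E * a 0 ∧
    a n * transferMatrix a b E n 1 0 = (blockPoly a b 0 n 1 0).eval E ∧
    a n * transferMatrix a b E n 1 1 = (blockPoly a b 0 n 1 1).eval E * a 0 := by
  induction n with
  | zero => simp [transferMatrix, blockPoly]
  | succ n ih =>
    obtain ⟨h1, h2, h3, h4⟩ := ih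
    have := (ha (n + 1)).ne'
    simp only [blockPoly_succ_zero, blockPoly_succ_one, eval_mul, eval_sub, eval_C, eval_X,
      ← h1, ← h3, zero_add]
    simp only [transferMatrix, Matrix.mul_apply, Fin.sum_univ_two, Matrix.of_apply,
      Matrix.cons_val_zero, Matrix.cons_val_one, Matrix.cons_val', Matrix.cons_val_fin_one]
    refine ⟨by field_simp; ring, ?_, by ring, ?_⟩
    · rw [h2]; field_simp
      linear_combination -h4
    · rw [h2]; ring

lemma discriminant_eq {a b : ℕ → ℝ} {p : ℕ} (ha : ∀ n, 0 < a n)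
    (hap : ∀ n, a (n + p) = a n) (E : ℝ) :
    discriminant a b p E = (discPoly a b p).eval E := by
  obtain ⟨h1, h2, h3, h4⟩ := transferMatrix_eq b ha E p
  have h0 : a p = a 0 := by simpa using hap 0
  rw [h0, mul_comm] at h4
  rw [discriminant, discPoly, Matrix.trace_fin_two, Matrix.trace_fin_two, eval_add, h1,
    mul_right_cancel₀ (ha 0).ne' h4]

/-! ### Christoffel–Darboux and Green identities -/

/-- The Wronskian of the solution and its energy derivative grows by `p_n(E)²` at each step. At a
zero of `p_{n+1}` it forces the derivative and `secondPoly` to have the same sign. -/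
lemma christoffelDarboux {a : ℕ → ℝ} (b : ℕ → ℝ) (ha : ∀ n, 1 ≤ n → 0 < a n) (E : ℝ) (n : ℕ) :
    0 < (derivative (orthoPoly a b (n + 1))).eval E * (secondPoly a b (n + 1)).eval E -
      (orthoPoly a b (n + 1)).eval E * (derivative (secondPoly a b (n + 1))).eval E := by
  have step : ∀ n, (derivative (orthoPoly a b (n + 1))).eval E * (secondPoly a b (n + 1)).eval E -
      (orthoPoly a b (n + 1)).eval E * (derivative (secondPoly a b (n + 1))).eval E =
      ((orthoPoly a b n).eval E) ^ 2 + ((derivative (orthoPoly a b n)).eval E *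
        (secondPoly a b n).eval E -
      (orthoPoly a b n).eval E * (derivative (secondPoly a b n)).eval E) := by
    intro n
    have := (ha (n + 1) (by omega)).ne'
    rw [orthoPoly_succ, secondPoly]
    simp only [derivative_mul, derivative_sub, derivative_C, derivative_X, eval_mul, eval_sub,
      eval_add, eval_C, eval_X, eval_zero, eval_one]
    field_simp
    ring
  induction n with
  | zero => rw [step]; simp [orthoPoly, secondPoly]
  | succ n ih => rw [step]; positivity

lemma green_identity {a b : ℕ → ℝ} (ha : ∀ n, 1 ≤ n → 0 < a n) {z : ℂ} {x y : ℕ → ℂ}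
    (hx : ∀ n, x (n + 1) = (a (n + 1) : ℂ)⁻¹ * ((z - b (n + 1)) * x n - y n))
    (hy : ∀ n, y (n + 1) = a (n + 1) * x n) (n : ℕ) :
    (x n * star (y n)).im = (x 0 * star (y 0)).im +
      z.im * ∑ j ∈ Finset.range n, Complex.normSq (x j) := by
  induction n with
  | zero => simp
  | succ n ih =>
    have h : (a (n + 1) : ℂ) ≠ 0 := by exact_mod_cast (ha (n + 1) (by omega)).ne'
    have e : x (n + 1) * star (y (n + 1)) = ((z - b (n + 1)) * x n - y n) * star (x n) := by
      rw [hx, hy]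
      simp only [RCLike.star_def, map_mul, Complex.conj_ofReal]
      field_simp
    rw [e, Finset.sum_range_succ, mul_add, ← add_assoc, ← ih]
    simp [Complex.normSq_apply]
    ring

/-! ### Real-rootedness from Green's identity -/

lemma splits_of_complex_roots_real {q : ℝ[X]} (h : ∀ z : ℂ, aeval z q = 0 → z.im = 0) :
    q.Splits := by
  refine Splits.of_splits_map (algebraMap ℝ ℂ) (IsAlgClosed.splits _) ?_
  intro z hz
  have hz' : aeval z q = 0 := by
    have := isRoot_of_mem_roots hz
    rwa [IsRoot, eval_map_algebraMap] at this
  exact ⟨z.re, by apply Complex.ext <;> simp [h z hz']⟩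

lemma orthoPoly_natDegree {a : ℕ → ℝ} (b : ℕ → ℝ) (ha : ∀ n, 1 ≤ n → 0 < a n) (n : ℕ) :
    (orthoPoly a b n).natDegree = n := by
  have h := (orthoPoly_add a b 0 n).1
  simp only [zero_add, orthoPoly, secondPoly, mul_one, mul_zero, add_zero] at h
  rw [h]
  exact le_antisymm (blockPoly_natDegree a b 0 n 0).1
    (le_natDegree_of_ne_zero (blockPoly_coeff_pos b ha 0 n).ne')

lemma orthoPoly_ne_zero {a : ℕ → ℝ} (b : ℕ → ℝ) (ha : ∀ n, 1 ≤ n → 0 < a n) (n : ℕ) :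
    orthoPoly a b n ≠ 0 := by
  intro h0
  have := orthoPoly_natDegree b ha n
  rw [h0, natDegree_zero] at this
  subst this
  simp [orthoPoly] at h0

/-- At a zero `z` of `p_n` both boundary terms of Green's identity vanish, leaving `Im z · ∑
|p_j(z)|² = 0`, and the sum contains `|p_0|² = 1`. -/
lemma orthoPoly_splits {a : ℕ → ℝ} (b : ℕ → ℝ) (ha : ∀ n, 1 ≤ n → 0 < a n) (n : ℕ) :
    (orthoPoly a b n).Splits := by
  apply splits_of_complex_roots_real
  intro z hz
  by_contra hne
  have hg := green_identity (b := b) ha (z := z) (x := fun n => aeval z (orthoPoly a b n))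
    (y := fun n => aeval z (secondPoly a b n))
    (fun n => by rw [orthoPoly_succ]; simp) (fun n => by simp [secondPoly]) n
  rcases n with _ | n
  · simp [orthoPoly] at hz
  have hpos : 0 < ∑ j ∈ Finset.range (n + 1), Complex.normSq (aeval z (orthoPoly a b j)) := by
    refine Finset.sum_pos' (fun _ _ => Complex.normSq_nonneg _) ⟨0, by simp, by simp [orthoPoly]⟩
  simp [hz, secondPoly, hne, hpos.ne'] at hg

lemma orthoPoly_card_roots {a : ℕ → ℝ} (b : ℕ → ℝ) (ha : ∀ n, 1 ≤ n → 0 < a n) (n : ℕ) :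
    Multiset.card (orthoPoly a b n).roots = n := by
  rw [← (orthoPoly_splits b ha n).natDegree_eq_card_roots, orthoPoly_natDegree b ha n]

/-- A nonzero solution that is quasiperiodic with a multiplier of modulus one has real energy. -/
lemma im_eq_zero_of_floquet {a b : ℕ → ℝ} (ha : ∀ n, 1 ≤ n → 0 < a n) {p : ℕ} (hp : 1 ≤ p)
    {z μ : ℂ} {x y : ℕ → ℂ}
    (hx : ∀ n, x (n + 1) = (a (n + 1) : ℂ)⁻¹ * ((z - b (n + 1)) * x n - y n))
    (hy : ∀ n, y (n + 1) = a (n + 1) * x n) (hμ : Complex.normSq μ = 1)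
    (hxp : x p = μ * x 0) (hyp : y p = μ * y 0) (h0 : x 0 ≠ 0 ∨ y 0 ≠ 0) : z.im = 0 := by
  by_contra hne
  have hg := green_identity ha hx hy p
  have hμ' : μ * star μ = 1 := by
    rw [RCLike.star_def, Complex.mul_conj, hμ, Complex.ofReal_one]
  have e : x p * star (y p) = x 0 * star (y 0) := by
    rw [hxp, hyp, star_mul]
    linear_combination (x 0 * star (y 0)) * hμ'
  rw [e, left_eq_add, mul_eq_zero, or_iff_right hne,
    Finset.sum_eq_zero_iff_of_nonneg (fun _ _ => Complex.normSq_nonneg _)] at hg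
  -- The sum over one period vanishes. Two consecutive zeros of `x` kill the whole solution; for `p
  -- = 1` the second one comes from quasiperiodicity.
  have hx0 : x 0 = 0 := by simpa using hg 0 (by simp; omega)
  have hx1 : x 1 = 0 := by
    rcases hp.eq_or_lt with rfl | hp
    · rw [hxp, hx0, mul_zero]
    · simpa using hg 1 (by simpa using hp)
  have h1 : (a 1 : ℂ) ≠ 0 := by exact_mod_cast (ha 1 le_rfl).ne'
  have := hx 0
  simp [hx0, hx1, h1] at this
  simp [hx0, this] at h0

lemma exists_eigenvector {A : Fin 2 → Fin 2 → ℂ} {μ : ℂ}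
    (hchar : (μ - A 0 0) * (μ - A 1 1) = A 0 1 * A 1 0) :
    ∃ v w : ℂ, (v ≠ 0 ∨ w ≠ 0) ∧
      A 0 0 * v + A 0 1 * w = μ * v ∧ A 1 0 * v + A 1 1 * w = μ * w := by
  by_cases hB : A 0 1 = 0
  · by_cases hD : μ = A 1 1
    · exact ⟨0, 1, Or.inr one_ne_zero, by simp [hB], by simp [hD]⟩
    · have : μ = A 0 0 := by
        rw [hB, zero_mul, mul_eq_zero, sub_eq_zero, sub_eq_zero] at hchar
        tauto
      exact ⟨μ - A 1 1, A 1 0, Or.inl (sub_ne_zero.2 hD), by rw [hB, ← this]; ring, by ring⟩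
  · exact ⟨A 0 1, μ - A 0 0, Or.inl hB, by ring, by linear_combination -hchar⟩

/-- The discriminant takes the values in `(-2, 2)` at real energies only. -/
lemma discPoly_sub_C_splits {a : ℕ → ℝ} (b : ℕ → ℝ) (ha : ∀ n, 1 ≤ n → 0 < a n) {p : ℕ}
    (hp : 1 ≤ p) {c : ℝ} (hc : |c| < 2) : (discPoly a b p - C c).Splits := by
  apply splits_of_complex_roots_real
  intro z hz
  have hc4 : c ^ 2 ≤ 4 := by nlinarith [abs_lt.1 hc, abs_nonneg c, sq_abs c]
  set s := Real.sqrt (1 - c ^ 2 / 4) with hs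
  have hs2 : s ^ 2 = 1 - c ^ 2 / 4 := Real.sq_sqrt (by linarith)
  -- A root of `μ² - cμ + 1` on the unit circle, available because `|c| < 2`: it is an eigenvalue of
  -- the period matrix at `z`.
  set μ : ℂ := ⟨c / 2, s⟩ with hμ
  have hμn : Complex.normSq μ = 1 := by
    rw [hμ, Complex.normSq_mk]; nlinarith
  have hμq : μ ^ 2 - c * μ + 1 = 0 := by
    apply Complex.ext
    · simp [pow_two, hμ]; nlinarith
    · simp [pow_two, hμ]; ring
  set A : Fin 2 → Fin 2 → ℂ := fun i j => aeval z (blockPoly a b 0 p i j) with hA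
  have htr : A 0 0 + A 1 1 = c := by
    rw [map_sub, aeval_C, sub_eq_zero] at hz
    rw [hA]
    simpa [discPoly, Matrix.trace_fin_two] using hz
  have hdet : A 0 0 * A 1 1 - A 0 1 * A 1 0 = 1 := by
    have := congrArg (aeval z) (blockPoly_det (b := b) ha 0 p)
    simpa [Matrix.det_fin_two] using this
  obtain ⟨v, w, hvw, h1, h2⟩ := exists_eigenvector (A := A) (μ := μ)
    (by linear_combination hμq - μ * htr + hdet)
  refine im_eq_zero_of_floquet (b := b) ha hp (μ := μ)
    (x := fun n => aeval z (blockPoly a b 0 n 0 0) * v + aeval z (blockPoly a b 0 n 0 1) * w)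
    (y := fun n => aeval z (blockPoly a b 0 n 1 0) * v + aeval z (blockPoly a b 0 n 1 1) * w)
    (fun n => ?_) (fun n => ?_) hμn ?_ ?_ ?_
  · simp only [blockPoly_succ_zero]; simp; ring
  · simp only [blockPoly_succ_one]; simp; ring
  · simpa [blockPoly] using h1
  · simpa [blockPoly] using h2
  · simpa [blockPoly] using hvw

/-! ### The Laguerre inequality -/

lemma laguerre_prod (s : Multiset ℝ) (x : ℝ) :
    0 ≤ ((derivative (s.map fun r => X - C r).prod).eval x) ^ 2 -
      ((s.map fun r => X - C r).prod).eval x *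
        (derivative (derivative (s.map fun r => X - C r).prod)).eval x ∧
    (s ≠ 0 → ((s.map fun r => X - C r).prod).eval x ≠ 0 →
      0 < ((derivative (s.map fun r => X - C r).prod).eval x) ^ 2 -
      ((s.map fun r => X - C r).prod).eval x *
        (derivative (derivative (s.map fun r => X - C r).prod)).eval x) := by
  induction s using Multiset.induction_on with
  | empty => simp
  | cons r s ih =>
    rw [Multiset.map_cons, Multiset.prod_cons]
    generalize (s.map fun r => X - C r).prod = t at ih
    -- The Laguerre expression `L(q) = q'² - q q''` satisfies `L((X - r) t) = t² + (x - r)² L(t)`,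
    -- so positivity propagates one root at a time.
    have e : ((derivative ((X - C r) * t)).eval x) ^ 2 -
        ((X - C r) * t).eval x * (derivative (derivative ((X - C r) * t))).eval x =
        (t.eval x) ^ 2 + (x - r) ^ 2 * (((derivative t).eval x) ^ 2 -
          t.eval x * (derivative (derivative t)).eval x) := by
      simp only [derivative_mul, derivative_sub, derivative_C, derivative_X, derivative_add,
        eval_mul, eval_sub, eval_add, eval_C, eval_X, sub_zero, one_mul]
      ring
    rw [e]
    have h0 := ih.1
    refine ⟨by positivity, fun _ hne => ?_⟩
    rw [eval_mul] at hne
    have := right_ne_zero_of_mul hne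
    positivity

lemma laguerre_pos {q : ℝ[X]} (hq : q.Splits) (hd : q.natDegree ≠ 0) {x : ℝ}
    (hx : q.eval x ≠ 0) :
    0 < ((derivative q).eval x) ^ 2 - q.eval x * (derivative (derivative q)).eval x := by
  have hr : q.roots ≠ 0 := by
    intro h
    rw [hq.natDegree_eq_card_roots, h] at hd
    simp at hd
  have h := hq.eq_prod_roots
  have key := (laguerre_prod q.roots x).2 hr
  generalize (q.roots.map fun r => X - C r).prod = t at h key
  rw [h, eval_mul, eval_C] at hx
  have := left_ne_zero_of_mul hx
  have := key (right_ne_zero_of_mul hx)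
  rw [h]
  simp only [derivative_C_mul, eval_mul, eval_C]
  nlinarith [mul_pos (pow_pos (abs_pos.2 ‹q.leadingCoeff ≠ 0›) 2) this, sq_abs q.leadingCoeff]

/-- If `Δ'(E) = 0`, Laguerre's inequality for `Δ - c` reads `(Δ(E) - c) Δ''(E) < 0`. Taking `c` on
either side of `Δ(E)` within `(-2, 2)`, here the midpoints towards `±2`, gives contradictory signs.
-/
lemma discPoly_derivative_ne_zero {a : ℕ → ℝ} (b : ℕ → ℝ) (ha : ∀ n, 1 ≤ n → 0 < a n) {p : ℕ}
    (hp : 1 ≤ p) {E : ℝ} (hE : |(discPoly a b p).eval E| < 2) :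
    (derivative (discPoly a b p)).eval E ≠ 0 := by
  intro h0
  set d := (discPoly a b p).eval E with hd
  have key : ∀ c, |c| < 2 → d ≠ c →
      0 < -((d - c) * (derivative (derivative (discPoly a b p))).eval E) := by
    intro c hc hdc
    have := laguerre_pos (discPoly_sub_C_splits b ha hp hc) (x := E)
      (by rw [natDegree_sub_C, discPoly_natDegree b hp ha]; omega)
      (by rw [eval_sub, eval_C]; exact sub_ne_zero.2 hdc)
    simpa [h0, hd] using this
  rw [abs_lt] at hE
  have h1 := key ((d - 2) / 2) (by rw [abs_lt]; constructor <;> linarith) (by intro h; linarith)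
  have h2 := key ((d + 2) / 2) (by rw [abs_lt]; constructor <;> linarith) (by intro h; linarith)
  nlinarith

/-! ### The Floquet phase -/

/-- The energies at which a discriminant is elliptic. -/
def ellipticSet (D : ℝ[X]) : Set ℝ := {x | |D.eval x| < 2}

/-- The principal Floquet phase `arccos (D / 2)`. -/
noncomputable def phase (D : ℝ[X]) (x : ℝ) : ℝ := Real.arccos (D.eval x / 2)

/-- The derivative of the principal Floquet phase. -/
noncomputable def phaseDeriv (D : ℝ[X]) (x : ℝ) : ℝ :=
  -((derivative D).eval x / Real.sqrt (4 - D.eval x ^ 2))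

lemma isOpen_ellipticSet (D : ℝ[X]) : IsOpen (ellipticSet D) :=
  isOpen_lt (by fun_prop) continuous_const

lemma four_sub_sq_pos {D : ℝ[X]} {x : ℝ} (hx : x ∈ ellipticSet D) : 0 < 4 - D.eval x ^ 2 := by
  have h := abs_lt.1 (show |D.eval x| < 2 from hx)
  nlinarith

lemma hasDerivAt_phase {D : ℝ[X]} {x : ℝ} (hx : x ∈ ellipticSet D) :
    HasDerivAt (phase D) (phaseDeriv D x) x := by
  have h := abs_lt.1 (show |D.eval x| < 2 from hx)
  have h1 := Real.hasDerivAt_arccos (x := D.eval x / 2) (by linarith) (by linarith)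
  have h2 := ((D.hasDerivAt x).div_const 2)
  have h3 := h1.comp x h2
  refine h3.congr_deriv ?_
  have e : Real.sqrt (1 - (D.eval x / 2) ^ 2) = Real.sqrt (4 - D.eval x ^ 2) / 2 := by
    rw [show 1 - (D.eval x / 2) ^ 2 = (4 - D.eval x ^ 2) / 2 ^ 2 by ring,
      Real.sqrt_div (four_sub_sq_pos hx).le, Real.sqrt_sq (by norm_num)]
  have := (Real.sqrt_pos.2 (four_sub_sq_pos hx)).ne'
  rw [e, phaseDeriv]
  field_simp

lemma continuousOn_phaseDeriv (D : ℝ[X]) : ContinuousOn (phaseDeriv D) (ellipticSet D) := by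
  unfold phaseDeriv
  refine (ContinuousOn.div (by fun_prop) (by fun_prop) fun x hx => ?_).neg
  exact (Real.sqrt_pos.2 (four_sub_sq_pos hx)).ne'

lemma phaseDeriv_ne_zero {a : ℕ → ℝ} (b : ℕ → ℝ) (ha : ∀ n, 1 ≤ n → 0 < a n) {p : ℕ}
    (hp : 1 ≤ p) {E : ℝ} (hE : E ∈ ellipticSet (discPoly a b p)) :
    phaseDeriv (discPoly a b p) E ≠ 0 :=
  neg_ne_zero.2 (div_ne_zero (discPoly_derivative_ne_zero b ha hp hE)
    (Real.sqrt_pos.2 (four_sub_sq_pos hE)).ne')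

/-- `Real.arccos` is constant outside `[-1, 1]`, so the phase is continuous across the band edges as
well, where it ceases to be given by `2 cos θ = D`. -/
lemma continuous_phase (D : ℝ[X]) : Continuous (phase D) := by
  unfold phase; fun_prop

lemma two_cos_phase {D : ℝ[X]} {x : ℝ} (hx : x ∈ ellipticSet D) :
    2 * Real.cos (phase D x) = D.eval x := by
  have h := abs_lt.1 (show |D.eval x| < 2 from hx)
  rw [phase, Real.cos_arccos (by linarith) (by linarith)]; ring

/-- A component of the elliptic set is open and convex, hence equal to the interior of its closure.
Taking interiors band by band thus leaves the closed gaps out. -/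
lemma bandInterior_eq {a b : ℕ → ℝ} {p : ℕ} (ha : ∀ n, 0 < a n) (hap : ∀ n, a (n + p) = a n) :
    bandInterior a b p = ellipticSet (discPoly a b p) := by
  have hS : {x | |discriminant a b p x| < 2} = ellipticSet (discPoly a b p) := by
    ext x; simp [ellipticSet, discriminant_eq ha hap]
  have hopen := isOpen_ellipticSet (discPoly a b p)
  ext x
  simp only [bandInterior, bands, hS, mem_iUnion, mem_ofPred_eq, exists_prop]
  constructor
  · rintro ⟨B, ⟨E, hE, rfl⟩, hx⟩
    have hE' : E ∈ ellipticSet (discPoly a b p) := by rw [← hS]; exact hE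
    have hco : IsOpen (connectedComponentIn (ellipticSet (discPoly a b p)) E) :=
      hopen.connectedComponentIn
    have hcv : Convex ℝ (connectedComponentIn (ellipticSet (discPoly a b p)) E) :=
      (isPreconnected_connectedComponentIn).ordConnected.convex
    have hne : (interior (connectedComponentIn (ellipticSet (discPoly a b p)) E)).Nonempty := by
      rw [hco.interior_eq]; exact ⟨E, mem_connectedComponentIn hE'⟩
    rw [hcv.interior_closure_eq_interior_of_nonempty_interior hne, hco.interior_eq] at hx
    exact connectedComponentIn_subset _ _ hx
  · intro hx
    refine ⟨_, ⟨x, ?_, rfl⟩, ?_⟩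
    · have := hx; rw [← hS] at this; exact this
    · exact interior_maximal subset_closure hopen.connectedComponentIn (mem_connectedComponentIn hx)

/-! ### Floquet solutions and the transfer matrix -/

lemma transferMatrix_det {a : ℕ → ℝ} (b : ℕ → ℝ) (ha : ∀ n, 0 < a n) (E : ℝ) (n : ℕ) :
    (transferMatrix a b E n).det = a 0 / a n := by
  induction n with
  | zero => simp [transferMatrix, (ha 0).ne']
  | succ n ih =>
    rw [transferMatrix, Matrix.det_mul, ih, Matrix.det_fin_two]
    have := (ha n).ne'
    have := (ha (n + 1)).ne'
    simp
    field_simp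

lemma transferMatrix_add {a b : ℕ → ℝ} {p : ℕ} (hap : ∀ n, a (n + p) = a n)
    (hbp : ∀ n, b (n + p) = b n) (E : ℝ) (n : ℕ) :
    transferMatrix a b E (n + p) = transferMatrix a b E n * transferMatrix a b E p := by
  induction n with
  | zero => simp [transferMatrix]
  | succ n ih =>
    rw [show n + 1 + p = (n + p) + 1 by omega, transferMatrix, ih, transferMatrix,
      show n + p + 1 = (n + 1) + p by omega, hap, hbp, hap, Matrix.mul_assoc]

lemma transferMatrix_solution {a b : ℕ → ℝ} (ha : ∀ n, 0 < a n) {E : ℝ} {u : ℕ → ℂ}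
    (hu : IsSolution a b E u) (n : ℕ) :
    u (n + 1) = transferMatrix a b E n 0 0 * u 1 + transferMatrix a b E n 0 1 * u 0 ∧
    u n = transferMatrix a b E n 1 0 * u 1 + transferMatrix a b E n 1 1 * u 0 := by
  induction n with
  | zero => simp [transferMatrix]
  | succ n ih =>
    have h0 : (a (n + 1) : ℂ) ≠ 0 := by exact_mod_cast (ha (n + 1)).ne'
    have h := hu n
    have h' : u (n + 2) = ((E - b (n + 1)) * u (n + 1) - a n * u n) / a (n + 1) := by
      rw [eq_div_iff h0]; linear_combination h
    simp only [transferMatrix, Matrix.mul_apply, Fin.sum_univ_two, Matrix.of_apply,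
      Matrix.cons_val_zero, Matrix.cons_val_one, Matrix.cons_val', Matrix.cons_val_fin_one]
    constructor
    · rw [show n + 1 + 1 = n + 2 from rfl, h', ih.1, ih.2]
      push_cast
      field_simp
      ring
    · rw [ih.1]; push_cast; ring

/-- The multiplier is an eigenvalue of the period matrix, whose determinant is one, so the trace is
`e^{ig} + e^{-ig}`. -/
lemma discriminant_of_floquet {a b : ℕ → ℝ} {p : ℕ} (ha : ∀ n, 0 < a n)
    (hap : ∀ n, a (n + p) = a n) {E g : ℝ} {u : ℕ → ℂ} (hu0 : u ≠ 0) (hu : IsSolution a b E u)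
    (hup : ∀ n, u (n + p) = Complex.exp (Complex.I * (g : ℂ)) * u n) :
    discriminant a b p E = 2 * Real.cos g := by
  set μ := Complex.exp (Complex.I * (g : ℂ)) with hμ
  have hne : u 1 ≠ 0 ∨ u 0 ≠ 0 := by
    by_contra! h
    apply hu0
    ext n
    rw [(transferMatrix_solution ha hu n).2, h.1, h.2]; simp
  have hdet := transferMatrix_det b ha E p
  have h0 : a p = a 0 := by simpa using hap 0
  rw [h0, div_self (ha 0).ne', Matrix.det_fin_two] at hdet
  obtain ⟨h1, h2⟩ := transferMatrix_solution ha hu p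
  have e1 := hup 1
  have e2 := hup 0
  rw [add_comm 1 p] at e1
  rw [zero_add] at e2
  rw [e1] at h1
  rw [e2] at h2
  set T := transferMatrix a b E p
  have hdet' : (T 0 0 : ℂ) * T 1 1 - T 0 1 * T 1 0 = 1 := by exact_mod_cast hdet
  have hchar : μ ^ 2 - (T 0 0 + T 1 1 : ℂ) * μ + 1 = 0 := by
    rcases hne with h | h
    · apply mul_right_cancel₀ h
      linear_combination (u 1) * (-hdet') + h1 * (μ - T 1 1) + h2 * (T 0 1)
    · apply mul_right_cancel₀ h
      linear_combination (u 0) * (-hdet') + h2 * (μ - T 0 0) + h1 * (T 1 0)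
  have hinv : μ * Complex.exp (-(Complex.I * (g : ℂ))) = 1 := by
    rw [hμ, ← Complex.exp_add, add_neg_cancel, Complex.exp_zero]
  have hμ0 : μ ≠ 0 := Complex.exp_ne_zero _
  have htr : (T 0 0 + T 1 1 : ℂ) = 2 * Complex.cos g := by
    rw [Complex.two_cos, mul_comm (g : ℂ), neg_mul, mul_comm (g : ℂ), ← hμ]
    apply mul_right_cancel₀ hμ0
    linear_combination -hchar - hinv
  rw [discriminant, Matrix.trace_fin_two]
  exact_mod_cast htr

lemma exists_floquet_solution {a b : ℕ → ℝ} {p : ℕ} (ha : ∀ n, 0 < a n)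
    (hap : ∀ n, a (n + p) = a n) (hbp : ∀ n, b (n + p) = b n) {E g : ℝ}
    (hg : discriminant a b p E = 2 * Real.cos g) :
    ∃ u : ℕ → ℂ, u ≠ 0 ∧ IsSolution a b E u ∧
      ∀ n, u (n + p) = Complex.exp (Complex.I * (g : ℂ)) * u n := by
  set μ := Complex.exp (Complex.I * (g : ℂ)) with hμ
  have hdet := transferMatrix_det b ha E p
  have h0 : a p = a 0 := by simpa using hap 0
  rw [h0, div_self (ha 0).ne', Matrix.det_fin_two] at hdet
  rw [discriminant, Matrix.trace_fin_two] at hg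
  set A : Fin 2 → Fin 2 → ℂ := fun i j => (transferMatrix a b E p i j : ℂ) with hA
  have hdet' : A 0 0 * A 1 1 - A 0 1 * A 1 0 = 1 := by
    simp only [hA]; exact_mod_cast hdet
  have hg' : A 0 0 + A 1 1 = 2 * Complex.cos g := by
    simp only [hA]; exact_mod_cast congrArg (fun x : ℝ => (x : ℂ)) hg
  have hinv : μ * Complex.exp (-(Complex.I * (g : ℂ))) = 1 := by
    rw [hμ, ← Complex.exp_add, add_neg_cancel, Complex.exp_zero]
  rw [Complex.two_cos, mul_comm (g : ℂ), neg_mul, mul_comm (g : ℂ), ← hμ] at hg'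
  have hchar : (μ - A 0 0) * (μ - A 1 1) = A 0 1 * A 1 0 := by
    linear_combination hdet' - μ * hg' - hinv
  obtain ⟨v, w, hvw, h1, h2⟩ := exists_eigenvector hchar
  have hnext : ∀ n i, transferMatrix a b E (n + 1) 1 i = transferMatrix a b E n 0 i := by
    intro n i
    simp [transferMatrix, Matrix.mul_apply, Fin.sum_univ_two]
  refine ⟨fun n => transferMatrix a b E n 1 0 * v + transferMatrix a b E n 1 1 * w, ?_, ?_, ?_⟩
  · intro h
    have e0 := congrFun h 0
    have e1 := congrFun h 1
    simp [transferMatrix] at e0 e1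
    tauto
  · intro n
    have h0 : (a (n + 1) : ℂ) ≠ 0 := by exact_mod_cast (ha (n + 1)).ne'
    rw [show n + 2 = n + 1 + 1 from rfl]
    simp only [hnext]
    simp only [transferMatrix, Matrix.mul_apply, Fin.sum_univ_two, Matrix.of_apply,
      Matrix.cons_val_zero, Matrix.cons_val_one, Matrix.cons_val', Matrix.cons_val_fin_one]
    push_cast
    field_simp
    ring
  · intro n
    simp only [transferMatrix_add hap hbp, Matrix.mul_apply, Fin.sum_univ_two]
    push_cast
    simp only [hA] at h1 h2
    linear_combination (transferMatrix a b E n 1 0 : ℂ) * h1 +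
      (transferMatrix a b E n 1 1 : ℂ) * h2

lemma exists_isFloquetPhase {a b : ℕ → ℝ} {p : ℕ} (hp : 1 ≤ p) (ha : ∀ n, 0 < a n)
    (hap : ∀ n, a (n + p) = a n) (hbp : ∀ n, b (n + p) = b n) :
    ∃ γ : ℝ → ℝ, IsFloquetPhase a b p γ := by
  set D := discPoly a b p with hD
  have hband : bandInterior a b p = ellipticSet D := bandInterior_eq ha hap
  -- `arccos (D / 2)` decreases exactly where `D` increases; on the other bands the conjugate
  -- multiplier gives the decreasing branch. `D'` keeps its sign near each elliptic energy, so `γ`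
  -- is locally one branch.
  set γ : ℝ → ℝ := fun E => if 0 < (derivative D).eval E then phase D E else -phase D E with hγ
  have hder : ∀ E ∈ ellipticSet D, HasDerivAt γ (-|phaseDeriv D E|) E := by
    intro E hE
    have hs := Real.sqrt_pos.2 (four_sub_sq_pos hE)
    have hc : Continuous fun x => (derivative D).eval x := by fun_prop
    rcases (discPoly_derivative_ne_zero b (fun n _ => ha n) hp hE).lt_or_gt with h | h
    · have hpd : 0 < phaseDeriv D E := neg_pos.2 (div_neg_of_neg_of_pos h hs)
      rw [abs_of_pos hpd]
      refine (hasDerivAt_phase hE).neg.congr_of_eventuallyEq ?_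
      filter_upwards [hc.continuousAt.eventually_lt continuousAt_const h] with x hx
      simp only [hγ, if_neg hx.not_gt, Pi.neg_apply]
    · have hpd : phaseDeriv D E < 0 := neg_neg_iff_pos.2 (div_pos h hs)
      rw [abs_of_neg hpd, neg_neg]
      refine (hasDerivAt_phase hE).congr_of_eventuallyEq ?_
      filter_upwards [continuousAt_const.eventually_lt hc.continuousAt h] with x hx
      simp only [hγ, if_pos hx]
  refine ⟨γ, ?_, ?_, ?_⟩
  · intro E hE
    rw [hband] at hE
    apply exists_floquet_solution ha hap hbp
    rw [discriminant_eq ha hap, ← hD, ← two_cos_phase hE]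
    simp only [hγ]
    split_ifs
    · rfl
    · rw [Real.cos_neg]
  · intro E hE
    exact (hder E (hband ▸ hE)).differentiableAt
  · intro E hE
    rw [hband] at hE
    rw [(hder E hE).deriv]
    exact neg_neg_iff_pos.2 (abs_pos.2 (phaseDeriv_ne_zero b (fun n _ => ha n) hp hE))

/-- Differentiating `D = 2 cos γ` and using `4 - D² = (2 sin γ)²` determines `|γ'|`; the sign is
part of the definition. No continuity of the branch across bands is needed. -/
lemma IsFloquetPhase.deriv_eq {a b : ℕ → ℝ} {p : ℕ} (ha : ∀ n, 0 < a n)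
    (hap : ∀ n, a (n + p) = a n) {γ : ℝ → ℝ}
    (hγ : IsFloquetPhase a b p γ) {E : ℝ} (hE : E ∈ ellipticSet (discPoly a b p)) :
    deriv γ E = -|phaseDeriv (discPoly a b p) E| := by
  have hband : bandInterior a b p = ellipticSet (discPoly a b p) := bandInterior_eq ha hap
  set D := discPoly a b p with hD
  have heq : ∀ x ∈ ellipticSet D, D.eval x = 2 * Real.cos (γ x) := by
    intro x hx
    obtain ⟨u, hu0, hu, hup⟩ := hγ.floquet x (hband.symm ▸ hx)
    rw [hD, ← discriminant_eq ha hap, discriminant_of_floquet ha hap hu0 hu hup]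
  have hE' := hE
  rw [← hband] at hE'
  have hd := (hγ.differentiableAt E hE').hasDerivAt
  have hneg := hγ.deriv_neg E hE'
  have h1 : HasDerivAt (fun x => D.eval x) (2 * (-Real.sin (γ E) * deriv γ E)) E := by
    refine (hd.cos.const_mul 2).congr_of_eventuallyEq ?_
    filter_upwards [(isOpen_ellipticSet D).mem_nhds hE] with x hx using heq x hx
  have h2 : (derivative D).eval E = 2 * (-Real.sin (γ E) * deriv γ E) :=
    (D.hasDerivAt E).unique h1
  have h3 : 4 - D.eval E ^ 2 = (2 * Real.sin (γ E)) ^ 2 := by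
    rw [heq E hE]; nlinarith [Real.sin_sq_add_cos_sq (γ E)]
  have h4 := four_sub_sq_pos hE
  have h5 : Real.sqrt (4 - D.eval E ^ 2) = |2 * Real.sin (γ E)| := by rw [h3, Real.sqrt_sq_eq_abs]
  have h6 : |2 * Real.sin (γ E)| ≠ 0 := by rw [← h5]; exact (Real.sqrt_pos.2 h4).ne'
  rw [phaseDeriv, abs_neg, abs_div, h5, abs_abs, h2,
    show 2 * (-Real.sin (γ E) * deriv γ E) = -((2 * Real.sin (γ E)) * deriv γ E) by ring,
    abs_neg, abs_mul, mul_div_cancel_left₀ _ h6, abs_of_neg hneg, neg_neg]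

/-! ### Asymptotically periodic sequences of bounded variation -/

/-- `f` is asymptotic to the bounded sequence `f₀`, and its `p`-step variation is summable. -/
structure AsympPeriodic (p : ℕ) (f f₀ : ℕ → ℝ) : Prop where
  bdd : ∃ M, ∀ n, |f₀ n| ≤ M
  lim : Tendsto (fun n => f n - f₀ n) atTop (𝓝 0)
  sum : Summable fun n => |f (n + p) - f n|

namespace AsympPeriodic

variable {p : ℕ} {f f₀ g g₀ : ℕ → ℝ}

lemma exists_bound_of_tendsto (hb : ∃ M, ∀ n, |f₀ n| ≤ M)
    (hl : Tendsto (fun n => f n - f₀ n) atTop (𝓝 0)) : ∃ M, ∀ n, |f n| ≤ M := by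
  obtain ⟨M, hM⟩ := hb
  obtain ⟨B, hB⟩ := hl.abs.bddAbove_range
  refine ⟨B + M, fun n => ?_⟩
  have h1 : |f n - f₀ n| ≤ B := hB ⟨n, rfl⟩
  calc |f n| = |(f n - f₀ n) + f₀ n| := by rw [sub_add_cancel]
    _ ≤ _ := (abs_add_le _ _).trans (add_le_add h1 (hM n))

lemma bdd' (hf : AsympPeriodic p f f₀) : ∃ M, ∀ n, |f n| ≤ M :=
  exists_bound_of_tendsto hf.bdd hf.lim

lemma const (p : ℕ) (c : ℝ) : AsympPeriodic p (fun _ => c) fun _ => c :=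
  ⟨⟨|c|, fun _ => le_rfl⟩, by simp, by simp⟩

lemma add (hf : AsympPeriodic p f f₀) (hg : AsympPeriodic p g g₀) :
    AsympPeriodic p (fun n => f n + g n) fun n => f₀ n + g₀ n := by
  obtain ⟨M, hM⟩ := hf.bdd
  obtain ⟨N, hN⟩ := hg.bdd
  refine ⟨⟨M + N, fun n => (abs_add_le _ _).trans (add_le_add (hM n) (hN n))⟩, ?_, ?_⟩
  · have := hf.lim.add hg.lim
    rw [add_zero] at this
    exact this.congr fun n => by ring
  · refine Summable.of_nonneg_of_le (fun _ => abs_nonneg _) (fun n => ?_) (hf.sum.add hg.sum)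
    rw [add_sub_add_comm]
    exact abs_add_le _ _

lemma mul (hf : AsympPeriodic p f f₀) (hg : AsympPeriodic p g g₀) :
    AsympPeriodic p (fun n => f n * g n) fun n => f₀ n * g₀ n := by
  obtain ⟨M₀, hM₀⟩ := hf.bdd
  obtain ⟨N₀, hN₀⟩ := hg.bdd
  obtain ⟨M, hM⟩ := hf.bdd'
  obtain ⟨N, hN⟩ := hg.bdd'
  have hM0 := (abs_nonneg _).trans (hM 0)
  have hM₀0 := (abs_nonneg _).trans (hM₀ 0)
  refine ⟨⟨M₀ * N₀, fun n => ?_⟩, ?_, ?_⟩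
  · rw [abs_mul]
    exact mul_le_mul (hM₀ n) (hN₀ n) (abs_nonneg _) hM₀0
  · have h1 : Tendsto (fun n => M * |g n - g₀ n| + N₀ * |f n - f₀ n|) atTop (𝓝 0) := by
      simpa using (hg.lim.abs.const_mul M).add (hf.lim.abs.const_mul N₀)
    refine squeeze_zero_norm (fun n => ?_) h1
    rw [Real.norm_eq_abs, show f n * g n - f₀ n * g₀ n =
      f n * (g n - g₀ n) + g₀ n * (f n - f₀ n) by ring]
    refine (abs_add_le _ _).trans ?_
    rw [abs_mul, abs_mul]
    gcongr
    · exact hM n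
    · exact hN₀ n
  · refine Summable.of_nonneg_of_le (fun _ => abs_nonneg _) (fun n => ?_)
      ((hg.sum.mul_left M).add (hf.sum.mul_left N))
    rw [show f (n + p) * g (n + p) - f n * g n =
      f (n + p) * (g (n + p) - g n) + g n * (f (n + p) - f n) by ring]
    refine (abs_add_le _ _).trans ?_
    rw [abs_mul, abs_mul]
    gcongr
    · exact hM _
    · exact hN n

lemma neg (hf : AsympPeriodic p f f₀) : AsympPeriodic p (fun n => -f n) fun n => -f₀ n := by
  simpa using (const p (-1)).mul hf

lemma sub (hf : AsympPeriodic p f f₀) (hg : AsympPeriodic p g g₀) :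
    AsympPeriodic p (fun n => f n - g n) fun n => f₀ n - g₀ n := by
  simpa [sub_eq_add_neg] using hf.add hg.neg

lemma shift (hf : AsympPeriodic p f f₀) (j : ℕ) :
    AsympPeriodic p (fun n => f (n + j)) fun n => f₀ (n + j) := by
  obtain ⟨M, hM⟩ := hf.bdd
  refine ⟨⟨M, fun n => hM _⟩, (tendsto_add_atTop_iff_nat j).2 hf.lim, ?_⟩
  refine ((summable_nat_add_iff j).2 hf.sum).congr fun n => ?_
  rw [add_right_comm]

lemma finset_sum {ι : Type*} (s : Finset ι) {f f₀ : ι → ℕ → ℝ}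
    (h : ∀ i ∈ s, AsympPeriodic p (f i) (f₀ i)) :
    AsympPeriodic p (fun n => ∑ i ∈ s, f i n) fun n => ∑ i ∈ s, f₀ i n := by
  classical
  induction s using Finset.induction_on with
  | empty => simpa using const p 0
  | insert i s hi ih =>
    simp only [Finset.sum_insert hi]
    exact (h i (by simp)).add (ih fun j hj => h j (by simp [hj]))

lemma inv (hf : AsympPeriodic p f f₀) {c : ℝ} (hc : 0 < c) (h₀ : ∀ n, c ≤ f₀ n)
    (hpos : ∀ n, 0 < f n) : AsympPeriodic p (fun n => (f n)⁻¹) fun n => (f₀ n)⁻¹ := by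
  have hb₀ : ∀ n, |(f₀ n)⁻¹| ≤ c⁻¹ := fun n => by
    rw [abs_of_pos (inv_pos.2 (hc.trans_le (h₀ n)))]
    exact inv_anti₀ hc (h₀ n)
  -- The lower bound on `f` itself holds only eventually; the finitely many remaining inverses are
  -- absorbed by `exists_bound_of_tendsto`.
  have hev : ∀ᶠ n in atTop, |(f n)⁻¹| ≤ (c / 2)⁻¹ := by
    filter_upwards [hf.lim.eventually (lt_mem_nhds (show -(c / 2) < 0 by linarith))] with n hn
    rw [abs_of_pos (inv_pos.2 (hpos n))]
    exact inv_anti₀ (by linarith) (by linarith [h₀ n])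
  have hlim : Tendsto (fun n => (f n)⁻¹ - (f₀ n)⁻¹) atTop (𝓝 0) := by
    have h1 : Tendsto (fun n => (c / 2)⁻¹ * c⁻¹ * |f n - f₀ n|) atTop (𝓝 0) := by
      simpa using hf.lim.abs.const_mul ((c / 2)⁻¹ * c⁻¹)
    refine squeeze_zero_norm' ?_ h1
    filter_upwards [hev] with n hn
    have := (hpos n).ne'
    have := (hc.trans_le (h₀ n)).ne'
    rw [Real.norm_eq_abs, show (f n)⁻¹ - (f₀ n)⁻¹ = -((f n)⁻¹ * (f₀ n)⁻¹ * (f n - f₀ n)) by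
      field_simp; ring, abs_neg, abs_mul, abs_mul]
    gcongr
    exact hb₀ n
  obtain ⟨M, hM⟩ := exists_bound_of_tendsto ⟨_, hb₀⟩ hlim
  refine ⟨⟨_, hb₀⟩, hlim, ?_⟩
  have hM0 := (abs_nonneg _).trans (hM 0)
  refine Summable.of_nonneg_of_le (fun _ => abs_nonneg _) (fun n => ?_) (hf.sum.mul_left (M * M))
  have := (hpos n).ne'
  have := (hpos (n + p)).ne'
  rw [show (f (n + p))⁻¹ - (f n)⁻¹ = -((f (n + p))⁻¹ * (f n)⁻¹ * (f (n + p) - f n)) by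
      field_simp; ring, abs_neg, abs_mul, abs_mul]
  gcongr
  · exact hM _
  · exact hM _

end AsympPeriodic

/-- Coefficientwise asymptotically periodic sequences of polynomials of bounded degree. -/
structure AsympPeriodicPoly (p : ℕ) (f f₀ : ℕ → ℝ[X]) : Prop where
  deg : ∃ d, ∀ n, (f n).natDegree ≤ d ∧ (f₀ n).natDegree ≤ d
  coeff : ∀ i, AsympPeriodic p (fun n => (f n).coeff i) fun n => (f₀ n).coeff i

namespace AsympPeriodicPoly

variable {p : ℕ} {f f₀ g g₀ : ℕ → ℝ[X]}

lemma const (p : ℕ) (q : ℝ[X]) : AsympPeriodicPoly p (fun _ => q) fun _ => q :=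
  ⟨⟨_, fun _ => ⟨le_rfl, le_rfl⟩⟩, fun _ => AsympPeriodic.const p _⟩

lemma C {u u₀ : ℕ → ℝ} (h : AsympPeriodic p u u₀) :
    AsympPeriodicPoly p (fun n => Polynomial.C (u n)) fun n => Polynomial.C (u₀ n) := by
  refine ⟨⟨0, fun n => by simp⟩, fun i => ?_⟩
  rcases i with _ | i
  · simpa using h
  · simpa [coeff_C] using AsympPeriodic.const p 0

lemma add (hf : AsympPeriodicPoly p f f₀) (hg : AsympPeriodicPoly p g g₀) :
    AsympPeriodicPoly p (fun n => f n + g n) fun n => f₀ n + g₀ n := by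
  obtain ⟨d, hd⟩ := hf.deg
  obtain ⟨e, he⟩ := hg.deg
  refine ⟨⟨max d e, fun n => ⟨?_, ?_⟩⟩, fun i => ?_⟩
  · exact (natDegree_add_le _ _).trans (max_le_max (hd n).1 (he n).1)
  · exact (natDegree_add_le _ _).trans (max_le_max (hd n).2 (he n).2)
  · simpa only [coeff_add] using (hf.coeff i).add (hg.coeff i)

lemma mul (hf : AsympPeriodicPoly p f f₀) (hg : AsympPeriodicPoly p g g₀) :
    AsympPeriodicPoly p (fun n => f n * g n) fun n => f₀ n * g₀ n := by
  obtain ⟨d, hd⟩ := hf.deg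
  obtain ⟨e, he⟩ := hg.deg
  refine ⟨⟨d + e, fun n => ⟨?_, ?_⟩⟩, fun i => ?_⟩
  · exact natDegree_mul_le.trans (add_le_add (hd n).1 (he n).1)
  · exact natDegree_mul_le.trans (add_le_add (hd n).2 (he n).2)
  · simp only [coeff_mul]
    exact AsympPeriodic.finset_sum _ fun j _ => (hf.coeff _).mul (hg.coeff _)

lemma sub (hf : AsympPeriodicPoly p f f₀) (hg : AsympPeriodicPoly p g g₀) :
    AsympPeriodicPoly p (fun n => f n - g n) fun n => f₀ n - g₀ n := by
  simpa [sub_eq_add_neg] using hf.add ((const p (-1)).mul hg)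

lemma derivative (hf : AsympPeriodicPoly p f f₀) :
    AsympPeriodicPoly p (fun n => Polynomial.derivative (f n))
      fun n => Polynomial.derivative (f₀ n) := by
  obtain ⟨d, hd⟩ := hf.deg
  refine ⟨⟨d, fun n => ⟨?_, ?_⟩⟩, fun i => ?_⟩
  · exact (natDegree_derivative_le _).trans ((Nat.sub_le _ _).trans (hd n).1)
  · exact (natDegree_derivative_le _).trans ((Nat.sub_le _ _).trans (hd n).2)
  · simp only [coeff_derivative]
    exact (hf.coeff _).mul (AsympPeriodic.const p _)

/-- Turns convergence and summable variation of finitely many coefficients into statements uniform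
in `|E| ≤ R`; since coefficient control passes to derivatives, the same holds for them. -/
lemma abs_eval_le {q : ℝ[X]} {d : ℕ} (hd : q.natDegree ≤ d) {R E : ℝ} (hE : |E| ≤ R) :
    |q.eval E| ≤ ∑ i ∈ Finset.range (d + 1), |q.coeff i| * R ^ i := by
  rw [eval_eq_sum_range' (Nat.lt_succ_of_le hd)]
  refine (Finset.abs_sum_le_sum_abs _ _).trans (Finset.sum_le_sum fun i _ => ?_)
  rw [abs_mul, abs_pow]
  gcongr

lemma eventually_eval (hf : AsympPeriodicPoly p f f₀) (R : ℝ) {ε : ℝ} (hε : 0 < ε) :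
    ∀ᶠ n in atTop, ∀ E, |E| ≤ R → |(f n).eval E - (f₀ n).eval E| < ε := by
  obtain ⟨d, hd⟩ := hf.deg
  have h : Tendsto (fun n => ∑ i ∈ Finset.range (d + 1), |(f n - f₀ n).coeff i| * R ^ i) atTop
      (𝓝 0) := by
    rw [show (0 : ℝ) = ∑ i ∈ Finset.range (d + 1), |(0 : ℝ)| * R ^ i by simp]
    refine tendsto_finsetSum _ fun i _ => ?_
    simp only [coeff_sub]
    exact (hf.coeff i).lim.abs.mul_const _
  filter_upwards [h.eventually (gt_mem_nhds hε)] with n hn E hE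
  rw [← eval_sub]
  exact (abs_eval_le ((natDegree_sub_le _ _).trans (max_le (hd n).1 (hd n).2)) hE).trans_lt hn

lemma exists_summable_eval (hf : AsympPeriodicPoly p f f₀) (R : ℝ) :
    ∃ c : ℕ → ℝ, Summable c ∧
      ∀ n E, |E| ≤ R → |(f (n + p)).eval E - (f n).eval E| ≤ c n := by
  obtain ⟨d, hd⟩ := hf.deg
  refine ⟨fun n => ∑ i ∈ Finset.range (d + 1), |(f (n + p) - f n).coeff i| * R ^ i, ?_, ?_⟩
  · refine summable_sum fun i _ => ?_
    simp only [coeff_sub]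
    exact (hf.coeff i).sum.mul_right _
  · intro n E hE
    rw [← eval_sub]
    exact abs_eval_le ((natDegree_sub_le _ _).trans (max_le (hd _).1 (hd n).1)) hE

end AsympPeriodicPoly

lemma exists_bound_of_periodic {f : ℕ → ℝ} {p : ℕ} (hp : 1 ≤ p) (hf : ∀ n, f (n + p) = f n) :
    ∃ M, ∀ n, |f n| ≤ M := by
  refine ⟨∑ i ∈ Finset.range p, |f i|, fun n => ?_⟩
  have h : f (n % p) = f n := Function.Periodic.map_mod_nat hf n
  rw [← h]
  exact Finset.single_le_sum (f := fun i => |f i|) (fun _ _ => abs_nonneg _)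
    (Finset.mem_range.2 (Nat.mod_lt n hp))

lemma blockPoly_asympPeriodic {p : ℕ} (hp : 1 ≤ p) {a₀ b₀ a b : ℕ → ℝ}
    (ha₀ : ∀ n, 0 < a₀ n) (ha : ∀ n, 1 ≤ n → 0 < a n)
    (ha₀p : ∀ n, a₀ (n + p) = a₀ n) (hb₀p : ∀ n, b₀ (n + p) = b₀ n)
    (hlim : Tendsto (fun n => |a n - a₀ n| + |b n - b₀ n|) atTop (𝓝 0))
    (hsum : Summable (fun n : ℕ =>
      |a (n + 1 + p) - a (n + 1)| + |b (n + 1 + p) - b (n + 1)|)) (j : ℕ) (i i' : Fin 2) :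
    AsympPeriodicPoly p (fun n => blockPoly a b n j i i') fun n => blockPoly a₀ b₀ n j i i' := by
  have hA : AsympPeriodic p (fun n => a (n + 1)) fun n => a₀ (n + 1) := by
    refine ⟨exists_bound_of_periodic hp fun n => ?_, ?_, ?_⟩
    · rw [add_right_comm, ha₀p]
    · refine squeeze_zero_norm (fun n => ?_) ((tendsto_add_atTop_iff_nat 1).2 hlim)
      exact le_add_of_nonneg_right (abs_nonneg _)
    · refine Summable.of_nonneg_of_le (fun _ => abs_nonneg _) (fun n => ?_) hsum
      rw [add_right_comm n p 1]
      exact le_add_of_nonneg_right (abs_nonneg _)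
  have hB : AsympPeriodic p (fun n => b (n + 1)) fun n => b₀ (n + 1) := by
    refine ⟨exists_bound_of_periodic hp fun n => ?_, ?_, ?_⟩
    · rw [add_right_comm, hb₀p]
    · refine squeeze_zero_norm (fun n => ?_) ((tendsto_add_atTop_iff_nat 1).2 hlim)
      exact le_add_of_nonneg_left (abs_nonneg _)
    · refine Summable.of_nonneg_of_le (fun _ => abs_nonneg _) (fun n => ?_) hsum
      rw [add_right_comm n p 1]
      exact le_add_of_nonneg_left (abs_nonneg _)
  obtain ⟨M, hM⟩ := exists_bound_of_periodic (f := fun n => (a₀ (n + 1))⁻¹) hp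
    (fun n => by rw [add_right_comm, ha₀p])
  have hM0 : 0 < M := (abs_pos.2 (inv_pos.2 (ha₀ (0 + 1))).ne').trans_le (hM 0)
  have hI : AsympPeriodic p (fun n => (a (n + 1))⁻¹) fun n => (a₀ (n + 1))⁻¹ := by
    refine hA.inv (inv_pos.2 hM0) (fun n => ?_) fun n => ha _ (by omega)
    have := hM n
    rw [abs_of_pos (inv_pos.2 (ha₀ _))] at this
    exact inv_le_of_inv_le₀ (ha₀ _) this
  induction j generalizing i with
  | zero => simpa only [blockPoly] using AsympPeriodicPoly.const p _
  | succ j ih =>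
    fin_cases i
    · simp only [Fin.zero_eta, blockPoly_succ_zero]
      exact (AsympPeriodicPoly.C (hI.shift j)).mul
        ((((AsympPeriodicPoly.const p X).sub (AsympPeriodicPoly.C (hB.shift j))).mul (ih 0)).sub
          (ih 1))
    · simp only [Fin.mk_one, blockPoly_succ_one]
      exact (AsympPeriodicPoly.C (hA.shift j)).mul (ih 0)

lemma blockPoly_add_period {a b : ℕ → ℝ} {p : ℕ} (ha : ∀ n, a (n + p) = a n)
    (hb : ∀ n, b (n + p) = b n) (n j : ℕ) :
    blockPoly a b (n + p) j = blockPoly a b n j := by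
  induction j with
  | zero => rfl
  | succ j ih =>
    rw [blockPoly, blockPoly, ih, show n + p + j + 1 = n + j + 1 + p by omega, ha, hb]

/-! ### The phase of a slowly varying elliptic recurrence -/

/-- Extend `f` to the line by its endpoint values and lift it through the covering `exp : ℂ → ℂ \
{0}`; the imaginary part of the lift is the argument. -/
lemma exists_continuousOn_arg {α β : ℝ} (hαβ : α ≤ β) {f : ℝ → ℂ}
    (hf : ContinuousOn f (Icc α β)) (h0 : ∀ E ∈ Icc α β, f E ≠ 0) :
    ∃ φ : ℝ → ℝ, ContinuousOn φ (Icc α β) ∧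
      ∀ E ∈ Icc α β, f E = ‖f E‖ * Complex.exp (Complex.I * φ E) := by
  set F : C(ℝ, ℂ) := ⟨IccExtend hαβ ((Icc α β).domRestrict f),
    (continuousOn_iff_continuous_domRestrict.1 hf).Icc_extend'⟩ with hF
  have hFne : ∀ E, F E ∈ ({0}ᶜ : Set ℂ) := fun E => by
    simp only [hF, ContinuousMap.coe_mk, IccExtend, Function.comp_apply, mem_compl_iff,
      mem_singleton_iff, domRestrict_apply]
    exact h0 _ (Subtype.prop _)
  obtain ⟨G, ⟨-, hG⟩, -⟩ := Complex.isCoveringMapOn_exp.existsUnique_continuousMap_lifts F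
    (a₀ := 0) (e₀ := Complex.log (F 0)) (Complex.exp_log (hFne 0)) hFne
  refine ⟨fun E => (G E).im, (Complex.continuous_im.comp G.continuous).continuousOn, ?_⟩
  intro E hE
  have h1 : Complex.exp (G E) = f E := by
    have := congrFun hG E
    simp only [Function.comp_apply, hF, ContinuousMap.coe_mk] at this
    rw [this, IccExtend_of_mem hαβ _ hE, domRestrict_apply]
  rw [← h1, Complex.norm_exp, Complex.ofReal_exp, ← Complex.exp_add]
  congr 1
  apply Complex.ext <;> simp

lemma exists_sum_Ico_le {e : ℕ → ℝ} (he : Summable e) (he0 : ∀ n, 0 ≤ e n) {ε : ℝ} (hε : 0 < ε) :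
    ∃ N, ∀ N' ≥ N, ∀ k, ∑ j ∈ Finset.Ico N' k, e j ≤ ε := by
  obtain ⟨N, hN⟩ := eventually_atTop.1 ((tendsto_sum_nat_add e).eventually (gt_mem_nhds hε))
  refine ⟨N, fun N' hN' k => ?_⟩
  rw [Finset.sum_Ico_eq_sum_range]
  refine le_trans ?_ (hN N' hN').le
  simp only [add_comm N']
  exact ((summable_nat_add_iff N').2 he).sum_le_tsum _ fun _ _ => he0 _

lemma exists_prod_near_one {K : Set ℝ} {u : ℕ → ℝ → ℂ} {e : ℕ → ℝ} (he : Summable e)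
    (he0 : ∀ n, 0 ≤ e n) (hu : ∀ k, ∀ E ∈ K, ‖u k E - 1‖ ≤ e k) {τ : ℝ} (hτ : 0 < τ) :
    ∃ N, ∀ N' ≥ N, ∀ k, ∀ E ∈ K, ‖∏ j ∈ Finset.Ico N' k, u j E - 1‖ < τ := by
  obtain ⟨σ, hσ, hσ'⟩ : ∃ σ > 0, Real.exp σ - 1 < τ := by
    have hc : ContinuousAt (fun s => Real.exp s - 1) 0 := by fun_prop
    have := hc.eventually_lt (continuousAt_const (y := τ)) (by simpa using hτ)
    obtain ⟨σ, hσ, h⟩ := Metric.eventually_nhds_iff.1 this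
    exact ⟨σ / 2, by linarith, h (by rw [Real.dist_eq, sub_zero, abs_of_pos] <;> linarith)⟩
  obtain ⟨N, hN⟩ := exists_sum_Ico_le he he0 hσ
  refine ⟨N, fun N' hN' k E hE => ?_⟩
  have h1 := Finset.norm_prod_one_add_sub_one_le (Finset.Ico N' k) fun j => u j E - 1
  simp only [add_sub_cancel] at h1
  refine h1.trans_lt (lt_of_le_of_lt (sub_le_sub_right (Real.exp_le_exp.2 ?_) 1) hσ')
  exact (Finset.sum_le_sum fun j _ => hu j E hE).trans (hN N' hN' k)

/-- A complex recurrence `ζ_{k+1} = e^{iθ_k} u_k ζ_k` with `∑ ‖u_k - 1‖ < ∞` has the phase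
`∑ θ_j + η_k`, where the `η_k` are uniformly bounded and asymptotically equicontinuous. -/
lemma exists_phase_of_factors {α β : ℝ} (hαβ : α ≤ β) {ζ u : ℕ → ℝ → ℂ} {θ : ℕ → ℝ → ℝ}
    {e : ℕ → ℝ} (he : Summable e) (hζc : ∀ k, ContinuousOn (ζ k) (Icc α β))
    (huc : ∀ k, ContinuousOn (u k) (Icc α β)) (hζ0 : ∀ k, ∀ E ∈ Icc α β, ζ k E ≠ 0)
    (hu : ∀ k, ∀ E ∈ Icc α β, ‖u k E - 1‖ ≤ e k)
    (hrec : ∀ k, ∀ E ∈ Icc α β,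
      ζ (k + 1) E = Complex.exp (Complex.I * θ k E) * u k E * ζ k E) :
    ∃ (N : ℕ) (η : ℕ → ℝ → ℝ), (∀ k ≥ N, ContinuousOn (η k) (Icc α β)) ∧
      (∃ M, ∀ k ≥ N, ∀ E ∈ Icc α β, |η k E| ≤ M) ∧
      (∀ ε > 0, ∃ δ > 0, ∃ N', ∀ k ≥ N', ∀ E ∈ Icc α β, ∀ E' ∈ Icc α β, |E - E'| < δ →
        |η k E - η k E'| < ε) ∧
      ∀ k ≥ N, ∀ E ∈ Icc α β, ζ k E = ‖ζ k E‖ *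
        Complex.exp (Complex.I * ((∑ j ∈ Finset.Ico N k, θ j E + η k E : ℝ) : ℂ)) := by
  have he0 : ∀ k, 0 ≤ e k := fun k => (norm_nonneg _).trans (hu k α (left_mem_Icc.2 hαβ))
  -- Distance less than one from `1` keeps all partial products from `N` on in the right half-plane,
  -- where the principal argument is continuous and additive.
  obtain ⟨N, hN⟩ := exists_prod_near_one he he0 hu one_pos
  set P : ℕ → ℕ → ℝ → ℂ := fun m k E => ∏ j ∈ Finset.Ico m k, u j E with hP
  have hre : ∀ N' ≥ N, ∀ k, ∀ E ∈ Icc α β, 0 < (P N' k E).re := by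
    intro N' hN' k E hE
    have h1 := (Complex.abs_re_le_norm _).trans_lt (hN N' hN' k E hE)
    rw [Complex.sub_re, Complex.one_re, abs_lt] at h1
    linarith
  obtain ⟨φ, hφc, hφ⟩ := exists_continuousOn_arg hαβ (hζc N) (hζ0 N)
  have hPc : ∀ k, ContinuousOn (fun E => (P N k E).arg) (Icc α β) := by
    intro k E hE
    refine ContinuousAt.comp_continuousWithinAt (f := P N k)
      (Complex.continuousAt_arg (Or.inl (hre N le_rfl k E hE))) ?_
    exact (continuousOn_finsetProd _ fun j _ => huc j) E hE
  refine ⟨N, fun k E => φ E + (P N k E).arg, fun k _ => hφc.add (hPc k), ?_, ?_, ?_⟩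
  · obtain ⟨M, hM⟩ := isCompact_Icc.exists_bound_of_continuousOn hφc
    exact ⟨M + Real.pi, fun k _ E hE => (abs_add_le _ _).trans
      (add_le_add (hM E hE) (Complex.abs_arg_le_pi _))⟩
  · intro ε hε
    obtain ⟨τ, hτ, hτ'⟩ : ∃ τ > 0, ∀ v : ℂ, ‖v - 1‖ < τ → |v.arg| < ε / 3 := by
      have hc : ContinuousAt (fun v : ℂ => |v.arg|) 1 :=
        (Complex.continuousAt_arg (by simp)).abs
      have := hc.eventually_lt (continuousAt_const (y := ε / 3))
        (by simpa using (by linarith : 0 < ε / 3))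
      obtain ⟨τ, hτ, h⟩ := Metric.eventually_nhds_iff.1 this
      exact ⟨τ, hτ, fun v hv => h (by rwa [dist_eq_norm])⟩
    obtain ⟨N₁, hN₁⟩ := exists_prod_near_one he he0 hu hτ
    set N' := max N N₁ with hN'
    have huni := isCompact_Icc.uniformContinuousOn_of_continuous (hφc.add (hPc N'))
    obtain ⟨δ, hδ, hδ'⟩ := Metric.uniformContinuousOn_iff.1 huni (ε / 3) (by linarith)
    refine ⟨δ, hδ, N', fun k hk E hE E' hE' hEE => ?_⟩
    -- The factor up to `N'` is one fixed uniformly continuous function; the tail after `N'` has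
    -- argument below `ε / 3` for every `k`. Hence `δ` does not depend on `k`.
    have hsplit : ∀ E ∈ Icc α β, (P N k E).arg = (P N N' E).arg + (P N' k E).arg := by
      intro E hE
      have h1 : P N k E = P N N' E * P N' k E := by
        simp only [hP]
        rw [Finset.prod_Ico_consecutive _ (le_max_left _ _) hk]
      have r1 := hre N le_rfl N' E hE
      have r2 := hre N' (le_max_left _ _) k E hE
      have a1 := abs_lt.1 (Complex.abs_arg_lt_pi_div_two_iff.2 (Or.inl r1))
      have a2 := abs_lt.1 (Complex.abs_arg_lt_pi_div_two_iff.2 (Or.inl r2))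
      rw [h1]
      refine Complex.arg_mul (fun h => by simp [h] at r1) (fun h => by simp [h] at r2) ?_
      constructor <;> linarith
    have h1 := abs_lt.1 (hτ' (P N' k E) (hN₁ N' (le_max_right _ _) k E hE))
    have h2 := abs_lt.1 (hτ' (P N' k E') (hN₁ N' (le_max_right _ _) k E' hE'))
    have h3 := hδ' E hE E' hE' hEE
    rw [Real.dist_eq, abs_lt] at h3
    simp only [Pi.add_apply] at h3
    simp only
    rw [hsplit E hE, hsplit E' hE', abs_lt]
    constructor <;> linarith
  · have hprod : ∀ k ≥ N, ∀ E ∈ Icc α β,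
        ζ k E = Complex.exp (Complex.I * (∑ j ∈ Finset.Ico N k, θ j E : ℝ)) * P N k E * ζ N E := by
      intro k hk E hE
      induction k, hk using Nat.le_induction with
      | base => simp [hP]
      | succ k hk ih =>
        rw [hrec k E hE, ih]
        simp only [hP, Finset.prod_Ico_succ_top hk, Finset.sum_Ico_succ_top hk]
        rw [Complex.ofReal_add, mul_add, Complex.exp_add]
        ring
    intro k hk E hE
    have h1 := hprod k hk E hE
    have h2 : ‖ζ k E‖ = ‖P N k E‖ * ‖ζ N E‖ := by
      rw [h1, norm_mul, norm_mul, mul_comm Complex.I, Complex.norm_exp_ofReal_mul_I, one_mul]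
    have h3 := Complex.norm_mul_exp_arg_mul_I (P N k E)
    rw [h2, h1, hφ E hE]
    nth_rewrite 1 [← h3]
    push_cast
    rw [norm_mul, mul_comm Complex.I (φ E : ℂ), Complex.norm_exp_ofReal_mul_I]
    simp only [mul_add, Complex.exp_add, Complex.norm_real, norm_norm]
    rw [mul_comm ((P N k E).arg : ℂ), mul_comm (φ E : ℂ)]
    push_cast
    ring

/-- Phases of a real planar recurrence with slowly varying complex left eigenvectors `(l_k, 1)`. -/
lemma exists_phase_of_eigenvector {α β : ℝ} (hαβ : α ≤ β) {x y θ : ℕ → ℝ → ℝ} {l : ℕ → ℝ → ℂ}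
    {c : ℕ → ℝ} {δ : ℝ} (hδ : 0 < δ) (hc : Summable c)
    (hxc : ∀ k, ContinuousOn (x k) (Icc α β)) (hyc : ∀ k, ContinuousOn (y k) (Icc α β))
    (hlc : ∀ k, ContinuousOn (l k) (Icc α β)) (hθc : ∀ k, ContinuousOn (θ k) (Icc α β))
    (hxy : ∀ k, ∀ E ∈ Icc α β, x k E ≠ 0 ∨ y k E ≠ 0)
    (hl : ∀ k, ∀ E ∈ Icc α β, δ ≤ |(l k E).im|)
    (hlv : ∀ k, ∀ E ∈ Icc α β, ‖l (k + 1) E - l k E‖ ≤ c k)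
    (hrec : ∀ k, ∀ E ∈ Icc α β, l k E * x (k + 1) E + y (k + 1) E =
      Complex.exp (Complex.I * θ k E) * (l k E * x k E + y k E)) :
    ∃ (N : ℕ) (η : ℕ → ℝ → ℝ), (∀ k ≥ N, ContinuousOn (η k) (Icc α β)) ∧
      (∃ M, ∀ k ≥ N, ∀ E ∈ Icc α β, |η k E| ≤ M) ∧
      (∀ ε > 0, ∃ δ > 0, ∃ N', ∀ k ≥ N', ∀ E ∈ Icc α β, ∀ E' ∈ Icc α β, |E - E'| < δ →
        |η k E - η k E'| < ε) ∧
      ∀ k ≥ N, ∀ E ∈ Icc α β,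
        (x k E = 0 ↔ Real.sin (∑ j ∈ Finset.Ico N k, θ j E + η k E) = 0) ∧
        (x k E = 0 → 0 < y k E * Real.cos (∑ j ∈ Finset.Ico N k, θ j E + η k E)) := by
  set ζ : ℕ → ℝ → ℂ := fun k E => l k E * x k E + y k E with hζ
  have hlne : ∀ k, ∀ E ∈ Icc α β, (l k E).im ≠ 0 := fun k E hE =>
    abs_pos.1 (hδ.trans_le (hl k E hE))
  have hζim : ∀ k E, (ζ k E).im = (l k E).im * x k E := fun k E => by simp [hζ]
  have hζ0 : ∀ k, ∀ E ∈ Icc α β, ζ k E ≠ 0 := by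
    intro k E hE h
    have h1 := hζim k E
    rw [h, Complex.zero_im, eq_comm, mul_eq_zero, or_iff_right (hlne k E hE)] at h1
    have h2 : y k E = 0 := by simpa [hζ, h1] using h
    exact (hxy k E hE).elim (fun h => h h1) fun h => h h2
  have hζc : ∀ k, ContinuousOn (ζ k) (Icc α β) := fun k =>
    ((hlc k).mul (Complex.continuous_ofReal.comp_continuousOn (hxc k))).add
      (Complex.continuous_ofReal.comp_continuousOn (hyc k))
  set u : ℕ → ℝ → ℂ := fun k E => ζ (k + 1) E / (Complex.exp (Complex.I * θ k E) * ζ k E) with hu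
  have hden : ∀ k, ∀ E ∈ Icc α β, Complex.exp (Complex.I * θ k E) * ζ k E ≠ 0 := fun k E hE =>
    mul_ne_zero (Complex.exp_ne_zero _) (hζ0 k E hE)
  have huc : ∀ k, ContinuousOn (u k) (Icc α β) := by
    exact fun k => (hζc (k + 1)).div
      ((Complex.continuous_exp.comp_continuousOn (continuousOn_const.mul
        (Complex.continuous_ofReal.comp_continuousOn (hθc k)))).mul (hζc k)) (hden k)
  have hue : ∀ k, ∀ E ∈ Icc α β, ‖u k E - 1‖ ≤ c k / δ := by
    intro k E hE
    have hd := hden k E hE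
    have h5 : ‖Complex.exp (Complex.I * θ k E) * ζ k E‖ = ‖ζ k E‖ := by
      rw [norm_mul, mul_comm Complex.I, Complex.norm_exp_ofReal_mul_I, one_mul]
    -- By the recurrence `e^{iθ_k} ζ_k = l_k x_{k+1} + y_{k+1}`, whose imaginary part is `Im l_k ·
    -- x_{k+1}`. This bounds the eigenvector error `(l_{k+1} - l_k) x_{k+1}` relative to `ζ_k`.
    have h6 : δ * |x (k + 1) E| ≤ ‖ζ k E‖ := by
      rw [← h5, hζ, ← hrec k E hE]
      refine le_trans ?_ (Complex.abs_im_le_norm _)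
      rw [show (l k E * x (k + 1) E + y (k + 1) E).im = (l k E).im * x (k + 1) E by simp, abs_mul]
      exact mul_le_mul_of_nonneg_right (hl k E hE) (abs_nonneg _)
    have h7 : u k E - 1 = (l (k + 1) E - l k E) * x (k + 1) E /
        (Complex.exp (Complex.I * θ k E) * ζ k E) := by
      rw [hu]
      simp only
      rw [div_sub_one hd]
      congr 1
      rw [hζ]
      simp only
      rw [← hrec k E hE]
      ring
    rw [h7, norm_div, h5, norm_mul, Complex.norm_real, Real.norm_eq_abs,
      div_le_div_iff₀ (norm_pos_iff.2 (hζ0 k E hE)) hδ]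
    have h8 := hlv k E hE
    calc ‖l (k + 1) E - l k E‖ * |x (k + 1) E| * δ
        ≤ c k * |x (k + 1) E| * δ := by gcongr
      _ = c k * (δ * |x (k + 1) E|) := by ring
      _ ≤ c k * ‖ζ k E‖ := by
        refine mul_le_mul_of_nonneg_left h6 ((norm_nonneg _).trans h8)
  have hur : ∀ k, ∀ E ∈ Icc α β,
      ζ (k + 1) E = Complex.exp (Complex.I * θ k E) * u k E * ζ k E := by
    intro k E hE
    rw [hu]
    have := hden k E hE
    have := hζ0 k E hE
    have := Complex.exp_ne_zero (Complex.I * θ k E)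
    field_simp
  obtain ⟨N, η, h1, h2, h3, h4⟩ :=
    exists_phase_of_factors hαβ (hc.div_const δ) hζc huc hζ0 hue hur
  refine ⟨N, η, h1, h2, h3, fun k hk E hE => ?_⟩
  have h5 := h4 k hk E hE
  have hn : 0 < ‖ζ k E‖ := norm_pos_iff.2 (hζ0 k E hE)
  set Φ := ∑ j ∈ Finset.Ico N k, θ j E + η k E
  -- Imaginary and real parts of `ζ = ‖ζ‖ e^{iΦ}`. The first locates the zeros of `x`; at such a
  -- zero `ζ = y` is real and the second fixes the sign of `cos Φ`.
  have e1 : (l k E).im * x k E = ‖ζ k E‖ * Real.sin Φ := by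
    rw [← hζim]
    conv_lhs => rw [h5]
    rw [mul_comm Complex.I, Complex.im_ofReal_mul, Complex.exp_ofReal_mul_I_im]
  have e2 : (l k E).re * x k E + y k E = ‖ζ k E‖ * Real.cos Φ := by
    have : (ζ k E).re = (l k E).re * x k E + y k E := by simp [hζ]
    rw [← this]
    conv_lhs => rw [h5]
    rw [mul_comm Complex.I, Complex.re_ofReal_mul, Complex.exp_ofReal_mul_I_re]
  have e3 : x k E = 0 ↔ Real.sin Φ = 0 := by
    constructor
    · intro h
      rw [h, mul_zero, eq_comm, mul_eq_zero, or_iff_right hn.ne'] at e1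
      exact e1
    · intro h
      rw [h, mul_zero, mul_eq_zero, or_iff_right (hlne k E hE)] at e1
      exact e1
  refine ⟨e3, fun h => ?_⟩
  have h6 := e3.1 h
  rw [h, mul_zero, zero_add] at e2
  have h7 := Real.sin_sq_add_cos_sq Φ
  rw [e2, mul_assoc]
  rw [h6] at h7
  nlinarith

/-- On the unit circle `(z - w)(w - z̄) = (2 Re z - 2 Re w) w`, and `|w - z̄| ≥ Im w + Im z`. So the
variation of an eigenvalue is controlled by that of the trace, away from `±1`. -/
lemma norm_sub_mul_le_of_unit {z w : ℂ} (hz : ‖z‖ = 1) (hw : ‖w‖ = 1) {s : ℝ}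
    (hzs : s ≤ z.im) (hws : s ≤ w.im) : ‖z - w‖ * (2 * s) ≤ |2 * z.re - 2 * w.re| := by
  have hz2 : z.re * z.re + z.im * z.im = 1 := by
    rw [← Complex.normSq_apply, Complex.normSq_eq_norm_sq, hz, one_pow]
  have hw2 : w.re * w.re + w.im * w.im = 1 := by
    rw [← Complex.normSq_apply, Complex.normSq_eq_norm_sq, hw, one_pow]
  have h1 : (z - w) * (w - (starRingEnd ℂ) z) = ((2 * z.re - 2 * w.re : ℝ) : ℂ) * w := by
    apply Complex.ext
    · simp; nlinarith
    · simp; ring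
  have h2 := congrArg norm h1
  rw [norm_mul, norm_mul, hw, mul_one, Complex.norm_real, Real.norm_eq_abs] at h2
  rw [← h2]
  refine mul_le_mul_of_nonneg_left ?_ (norm_nonneg _)
  refine le_trans ?_ (Complex.abs_im_le_norm _)
  refine le_trans ?_ (le_abs_self _)
  simp; linarith

/-- Phases of a real planar recurrence with uniformly elliptic unimodular matrices of summable
variation. -/
lemma exists_phase_of_elliptic {α β : ℝ} (hαβ : α ≤ β) {x y A B C D : ℕ → ℝ → ℝ}
    {c : ℕ → ℝ} {δ τ M : ℝ} (hδ : 0 < δ) (hτ0 : 0 ≤ τ) (hτ : τ < 2) (hc : Summable c)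
    (hxc : ∀ k, ContinuousOn (x k) (Icc α β)) (hyc : ∀ k, ContinuousOn (y k) (Icc α β))
    (hAc : ∀ k, ContinuousOn (A k) (Icc α β)) (hBc : ∀ k, ContinuousOn (B k) (Icc α β))
    (hDc : ∀ k, ContinuousOn (D k) (Icc α β))
    (hxy : ∀ k, ∀ E ∈ Icc α β, x k E ≠ 0 ∨ y k E ≠ 0)
    (hdet : ∀ k, ∀ E ∈ Icc α β, A k E * D k E - B k E * C k E = 1)
    (htr : ∀ k, ∀ E ∈ Icc α β, |A k E + D k E| ≤ τ)
    (hB : ∀ k, ∀ E ∈ Icc α β, δ ≤ |B k E|) (hBM : ∀ k, ∀ E ∈ Icc α β, |B k E| ≤ M)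
    (hDM : ∀ k, ∀ E ∈ Icc α β, |D k E| ≤ M)
    (hAv : ∀ k, ∀ E ∈ Icc α β, |A (k + 1) E - A k E| ≤ c k)
    (hBv : ∀ k, ∀ E ∈ Icc α β, |B (k + 1) E - B k E| ≤ c k)
    (hDv : ∀ k, ∀ E ∈ Icc α β, |D (k + 1) E - D k E| ≤ c k)
    (hx : ∀ k, ∀ E ∈ Icc α β, x (k + 1) E = A k E * x k E + B k E * y k E)
    (hy : ∀ k, ∀ E ∈ Icc α β, y (k + 1) E = C k E * x k E + D k E * y k E) :
    ∃ (N : ℕ) (η : ℕ → ℝ → ℝ), (∀ k ≥ N, ContinuousOn (η k) (Icc α β)) ∧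
      (∃ M, ∀ k ≥ N, ∀ E ∈ Icc α β, |η k E| ≤ M) ∧
      (∀ ε > 0, ∃ δ > 0, ∃ N', ∀ k ≥ N', ∀ E ∈ Icc α β, ∀ E' ∈ Icc α β, |E - E'| < δ →
        |η k E - η k E'| < ε) ∧
      ∀ k ≥ N, ∀ E ∈ Icc α β,
        (x k E = 0 ↔ Real.sin (∑ j ∈ Finset.Ico N k, Real.arccos ((A j E + D j E) / 2) +
          η k E) = 0) ∧
        (x k E = 0 → 0 < y k E * Real.cos (∑ j ∈ Finset.Ico N k,
          Real.arccos ((A j E + D j E) / 2) + η k E)) := by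
  set θ : ℕ → ℝ → ℝ := fun k E => Real.arccos ((A k E + D k E) / 2) with hθ
  set lam : ℕ → ℝ → ℂ := fun k E => Complex.exp (Complex.I * θ k E) with hlam
  have hlre : ∀ k, ∀ E ∈ Icc α β, (lam k E).re = (A k E + D k E) / 2 := by
    intro k E hE
    have h := abs_le.1 (htr k E hE)
    simp only [hlam, hθ]
    rw [mul_comm, Complex.exp_ofReal_mul_I_re, Real.cos_arccos] <;> linarith
  set s := Real.sqrt (1 - (τ / 2) ^ 2) with hs
  have hs0 : 0 < s := Real.sqrt_pos.2 (by nlinarith)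
  have hlim : ∀ k, ∀ E ∈ Icc α β, s ≤ (lam k E).im := by
    intro k E hE
    simp only [hlam, hθ]
    rw [mul_comm, Complex.exp_ofReal_mul_I_im, Real.sin_arccos]
    apply Real.sqrt_le_sqrt
    have h := htr k E hE
    have h2 : (A k E + D k E) ^ 2 ≤ τ ^ 2 := by
      rw [← sq_abs]; exact pow_le_pow_left₀ (abs_nonneg _) h 2
    nlinarith
  have hln : ∀ k E, ‖lam k E‖ = 1 := fun k E => by
    simp only [hlam]; rw [mul_comm, Complex.norm_exp_ofReal_mul_I]
  have hchar : ∀ k, ∀ E ∈ Icc α β, lam k E ^ 2 - (A k E + D k E) * lam k E + 1 = 0 := by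
    intro k E hE
    have h1 : (lam k E).re * (lam k E).re + (lam k E).im * (lam k E).im = 1 := by
      rw [← Complex.normSq_apply, Complex.normSq_eq_norm_sq, hln, one_pow]
    have h2 := hlre k E hE
    have h3 : A k E + D k E = 2 * (lam k E).re := by linarith
    have h4 : (A k E + D k E : ℂ) = ((2 * (lam k E).re : ℝ) : ℂ) := by exact_mod_cast h3
    rw [h4]
    apply Complex.ext
    · simp [pow_two]; nlinarith
    · simp [pow_two]; ring
  have hB0 : ∀ k, ∀ E ∈ Icc α β, B k E ≠ 0 := fun k E hE =>
    abs_pos.1 (hδ.trans_le (hB k E hE))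
  have hBC0 : ∀ k, ∀ E ∈ Icc α β, (B k E : ℂ) ≠ 0 := fun k E hE => by
    exact_mod_cast hB0 k E hE
  have hM : 0 < M := hδ.trans_le ((hB 0 α (left_mem_Icc.2 hαβ)).trans
    (hBM 0 α (left_mem_Icc.2 hαβ)))
  have hθc : ∀ k, ContinuousOn (θ k) (Icc α β) := fun k =>
    Real.continuous_arccos.comp_continuousOn (((hAc k).add (hDc k)).div_const 2)
  have hlamc : ∀ k, ContinuousOn (lam k) (Icc α β) := fun k =>
    Complex.continuous_exp.comp_continuousOn (continuousOn_const.mul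
      (Complex.continuous_ofReal.comp_continuousOn (hθc k)))
  -- `(l, 1)` is a left eigenvector: `l B + D = λ` by the choice of `l`, and `l A + C = λ l` is the
  -- characteristic equation. The two terms of `c` bound the variation of the numerator `λ - D` and
  -- of the denominator `B`.
  refine exists_phase_of_eigenvector hαβ (θ := θ) (l := fun k E => (lam k E - D k E) / B k E)
    (c := fun k => (s⁻¹ + 1) * c k / δ + (1 + M) * c k / (δ * δ)) (δ := s / M) (by positivity)
    (((hc.mul_left _).div_const _).add ((hc.mul_left _).div_const _)) hxc hyc ?_ hθc hxy ?_ ?_ ?_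
  · exact fun k => ((hlamc k).sub (Complex.continuous_ofReal.comp_continuousOn (hDc k))).div
      (Complex.continuous_ofReal.comp_continuousOn (hBc k)) (hBC0 k)
  · intro k E hE
    rw [Complex.div_ofReal_im, Complex.sub_im, Complex.ofReal_im, sub_zero, abs_div]
    have h1 := hlim k E hE
    have h2 := hBM k E hE
    have h3 := abs_pos.2 (hB0 k E hE)
    rw [abs_of_pos (hs0.trans_le h1)]
    exact div_le_div₀ (hs0.le.trans h1) h1 h3 h2
  · intro k E hE
    have hb := hBC0 k E hE
    have hb' := hBC0 (k + 1) E hE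
    have hck : 0 ≤ c k := (abs_nonneg _).trans (hAv k E hE)
    have h1 : ‖lam (k + 1) E - lam k E‖ ≤ s⁻¹ * c k := by
      have h2 := norm_sub_mul_le_of_unit (hln (k + 1) E) (hln k E) (hlim _ E hE)
        (hlim _ E hE)
      rw [hlre _ E hE, hlre _ E hE] at h2
      have h3 : |2 * ((A (k + 1) E + D (k + 1) E) / 2) - 2 * ((A k E + D k E) / 2)| ≤ 2 * c k := by
        rw [show 2 * ((A (k + 1) E + D (k + 1) E) / 2) - 2 * ((A k E + D k E) / 2) =
          (A (k + 1) E - A k E) + (D (k + 1) E - D k E) by ring]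
        refine (abs_add_le _ _).trans ?_
        linarith [hAv k E hE, hDv k E hE]
      rw [inv_mul_eq_div, le_div_iff₀ hs0]
      linarith
    have e : (lam (k + 1) E - D (k + 1) E) / B (k + 1) E - (lam k E - D k E) / B k E =
        ((lam (k + 1) E - lam k E) - ((D (k + 1) E - D k E : ℝ) : ℂ)) / B (k + 1) E -
        (lam k E - D k E) * ((B (k + 1) E - B k E : ℝ) : ℂ) / (B (k + 1) E * B k E) := by
      push_cast
      field_simp
      ring
    rw [e]
    refine (norm_sub_le _ _).trans (add_le_add ?_ ?_)
    · rw [norm_div, Complex.norm_real, Real.norm_eq_abs]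
      refine div_le_div₀ (by positivity) ?_ hδ (hB _ E hE)
      refine (norm_sub_le _ _).trans ?_
      rw [Complex.norm_real, Real.norm_eq_abs, add_mul, one_mul]
      exact add_le_add h1 (hDv k E hE)
    · rw [norm_div, norm_mul, norm_mul, Complex.norm_real, Complex.norm_real, Complex.norm_real,
        Real.norm_eq_abs, Real.norm_eq_abs, Real.norm_eq_abs]
      refine div_le_div₀ (by positivity) ?_ (by positivity)
        (mul_le_mul (hB _ E hE) (hB _ E hE) hδ.le (abs_nonneg _))
      refine mul_le_mul ?_ (hBv k E hE) (abs_nonneg _) (by positivity)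
      refine (norm_sub_le _ _).trans ?_
      rw [hln, Complex.norm_real, Real.norm_eq_abs]
      linarith [hDM k E hE]
  · intro k E hE
    have hb := hBC0 k E hE
    have h1 := hchar k E hE
    have h2 : (A k E * D k E - B k E * C k E : ℂ) = 1 := by exact_mod_cast hdet k E hE
    rw [hx k E hE, hy k E hE]
    change _ = lam k E * _
    push_cast
    field_simp
    linear_combination (-(x k E : ℂ)) * h1 - (x k E : ℂ) * h2

/-! ### Phases of the orthonormal polynomials -/

/-- Jacobi parameters asymptotic to `p`-periodic ones, with summable `p`-step variation. -/
structure PeriodicLimit (p : ℕ) (a₀ b₀ a b : ℕ → ℝ) : Prop where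
  hp : 1 ≤ p
  ha₀ : ∀ n, 0 < a₀ n
  ha : ∀ n, 1 ≤ n → 0 < a n
  ha₀p : ∀ n, a₀ (n + p) = a₀ n
  hb₀p : ∀ n, b₀ (n + p) = b₀ n
  hlim : Tendsto (fun n => |a n - a₀ n| + |b n - b₀ n|) atTop (𝓝 0)
  hsum : Summable (fun n : ℕ => |a (n + 1 + p) - a (n + 1)| + |b (n + 1 + p) - b (n + 1)|)

/-- The trace of the product of the one-step matrices over the `j`-th period, starting at `r`. -/
noncomputable def periodTrace (a b : ℕ → ℝ) (p r j : ℕ) : ℝ[X] :=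
  (blockPoly a b (j * p + r) p).trace

namespace PeriodicLimit

variable {p : ℕ} {a₀ b₀ a b : ℕ → ℝ}

lemma asymp (h : PeriodicLimit p a₀ b₀ a b) (j : ℕ) (i i' : Fin 2) :
    AsympPeriodicPoly p (fun n => blockPoly a b n j i i') fun n => blockPoly a₀ b₀ n j i i' :=
  blockPoly_asympPeriodic h.hp h.ha₀ h.ha h.ha₀p h.hb₀p h.hlim h.hsum j i i'

lemma tendsto_index (h : PeriodicLimit p a₀ b₀ a b) (r : ℕ) :
    Tendsto (fun j : ℕ => j * p + r) atTop atTop :=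
  tendsto_atTop_mono (fun j => (Nat.le_mul_of_pos_right j h.hp).trans (Nat.le_add_right _ _))
    tendsto_id

lemma block_period (h : PeriodicLimit p a₀ b₀ a b) (r j : ℕ) :
    blockPoly a₀ b₀ (j * p + r) p = blockPoly a₀ b₀ r p := by
  induction j with
  | zero => simp
  | succ j ih =>
    rw [show (j + 1) * p + r = j * p + r + p by ring, blockPoly_add_period h.ha₀p h.hb₀p, ih]

lemma trace_asymp (h : PeriodicLimit p a₀ b₀ a b) :
    AsympPeriodicPoly p (fun n => (blockPoly a b n p).trace) fun _ => discPoly a₀ b₀ p := by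
  have h1 := (h.asymp p 0 0).add (h.asymp p 1 1)
  simp only [← Matrix.trace_fin_two] at h1
  simpa only [discPoly, blockPoly_trace_periodic h.hp h.ha₀p h.hb₀p] using h1

lemma eventually_trace (h : PeriodicLimit p a₀ b₀ a b) (r : ℕ) (R : ℝ) {ε : ℝ} (hε : 0 < ε) :
    ∀ᶠ j in atTop, ∀ E, |E| ≤ R →
      |(periodTrace a b p r j).eval E - (discPoly a₀ b₀ p).eval E| < ε :=
  (h.tendsto_index r).eventually (h.trace_asymp.eventually_eval R hε)

lemma eventually_trace_derivative (h : PeriodicLimit p a₀ b₀ a b) (r : ℕ) (R : ℝ) {ε : ℝ}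
    (hε : 0 < ε) :
    ∀ᶠ j in atTop, ∀ E, |E| ≤ R → |(derivative (periodTrace a b p r j)).eval E -
      (derivative (discPoly a₀ b₀ p)).eval E| < ε :=
  (h.tendsto_index r).eventually (h.trace_asymp.derivative.eventually_eval R hε)

end PeriodicLimit

lemma abs_le_max_of_mem_Icc {α β E : ℝ} (hE : E ∈ Icc α β) : |E| ≤ max |α| |β| :=
  abs_le_max_abs_abs hE.1 hE.2

lemma exists_trace_bound {D : ℝ[X]} {α β : ℝ} (hK : Icc α β ⊆ ellipticSet D) :
    ∃ τ, 0 ≤ τ ∧ τ < 2 ∧ ∀ E ∈ Icc α β, |D.eval E| ≤ τ := by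
  rcases (Icc α β).eq_empty_or_nonempty with h0 | hne
  · exact ⟨0, le_rfl, by norm_num, by simp [h0]⟩
  obtain ⟨E₀, hE₀, hmax⟩ := isCompact_Icc.exists_isMaxOn hne
    (f := fun E => |D.eval E|) (by fun_prop)
  exact ⟨|D.eval E₀|, abs_nonneg _, hK hE₀, fun E hE => hmax hE⟩

namespace PeriodicLimit

variable {p : ℕ} {a₀ b₀ a b : ℕ → ℝ}

lemma eventually_elliptic (h : PeriodicLimit p a₀ b₀ a b) (r : ℕ) {α β : ℝ}
    (hK : Icc α β ⊆ ellipticSet (discPoly a₀ b₀ p)) :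
    ∀ᶠ j in atTop, Icc α β ⊆ ellipticSet (periodTrace a b p r j) := by
  obtain ⟨τ, -, hτ2, hτ⟩ := exists_trace_bound hK
  filter_upwards [h.eventually_trace r (max |α| |β|) (sub_pos.2 hτ2)] with j hj E hE
  have h1 := hj E (abs_le_max_of_mem_Icc hE)
  have h2 := hτ E hE
  have h3 := abs_sub_abs_le_abs_sub ((periodTrace a b p r j).eval E)
    ((discPoly a₀ b₀ p).eval E)
  change |(periodTrace a b p r j).eval E| < 2
  linarith

lemma eventually_phaseDeriv (h : PeriodicLimit p a₀ b₀ a b) (r : ℕ) {α β : ℝ}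
    (hK : Icc α β ⊆ ellipticSet (discPoly a₀ b₀ p)) {ε : ℝ} (hε : 0 < ε) :
    ∀ᶠ j in atTop, ∀ E ∈ Icc α β,
      |phaseDeriv (periodTrace a b p r j) E - phaseDeriv (discPoly a₀ b₀ p) E| < ε := by
  set D := discPoly a₀ b₀ p with hD
  set F : ℝ × ℝ → ℝ := fun v => -(v.1 / Real.sqrt (4 - v.2 ^ 2)) with hF
  set κ : ℝ → ℝ × ℝ := fun E => ((derivative D).eval E, D.eval E) with hκ
  have hcomp : IsCompact (κ '' Icc α β) := isCompact_Icc.image (by fun_prop)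
  have hcont : ∀ v ∈ κ '' Icc α β, ContinuousAt F v := by
    rintro _ ⟨E, hE, rfl⟩
    have h1 := (Real.sqrt_pos.2 (four_sub_sq_pos (hK hE))).ne'
    exact (continuousAt_fst.div (f := Prod.fst) (g := fun v : ℝ × ℝ => Real.sqrt (4 - v.2 ^ 2))
      (by fun_prop) h1).neg
  -- Only one of the two points must lie in the compact image, so the nearby values coming from the
  -- `j`-th period are allowed.
  have h1 := hcomp.uniformContinuousAt_of_continuousAt F hcont (Metric.dist_mem_uniformity hε)
  obtain ⟨δ, hδ, h2⟩ := Metric.mem_uniformity_dist.1 h1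
  filter_upwards [h.eventually_trace r (max |α| |β|) hδ,
    h.eventually_trace_derivative r (max |α| |β|) hδ] with j h3 h4 E hE
  have h5 := h2 (a := κ E)
    (b := ((derivative (periodTrace a b p r j)).eval E, (periodTrace a b p r j).eval E)) ?_
    (mem_image_of_mem κ hE)
  · have h6 : dist (F (κ E)) (F ((derivative (periodTrace a b p r j)).eval E,
      (periodTrace a b p r j).eval E)) < ε := h5
    rw [dist_comm, Real.dist_eq] at h6
    exact h6
  · rw [dist_comm, Prod.dist_eq, max_lt_iff, Real.dist_eq, Real.dist_eq]
    exact ⟨h4 E (abs_le_max_of_mem_Icc hE), h3 E (abs_le_max_of_mem_Icc hE)⟩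

lemma tendsto_phase (h : PeriodicLimit p a₀ b₀ a b) (r : ℕ) (E : ℝ) :
    Tendsto (fun j => phase (periodTrace a b p r j) E) atTop
      (𝓝 (phase (discPoly a₀ b₀ p) E)) := by
  unfold phase
  refine (Real.continuous_arccos.tendsto _).comp (Tendsto.div_const ?_ 2)
  rw [Metric.tendsto_nhds]
  intro ε hε
  filter_upwards [h.eventually_trace r |E| hε] with j hj
  exact hj E le_rfl

lemma eval_ne_zero (h : PeriodicLimit p a₀ b₀ a b) (E : ℝ) (n : ℕ) :
    (orthoPoly a b n).eval E ≠ 0 ∨ (secondPoly a b n).eval E ≠ 0 := by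
  induction n with
  | zero => simp [orthoPoly]
  | succ n ih =>
    by_contra! hn
    have ha := (h.ha (n + 1) (by omega)).ne'
    rw [orthoPoly_succ, secondPoly] at hn
    simp only [eval_mul, eval_C, eval_sub, eval_X, mul_eq_zero, inv_eq_zero, ha, false_or] at hn
    obtain ⟨h1, h2⟩ := hn
    rw [h2, mul_zero, zero_sub, neg_eq_zero] at h1
    exact ih.elim (fun h => h h2) fun h => h h1

/-- Along the residue class of `r`, the zeros of `p_n` are given by a phase that is, up to a bounded
and asymptotically equicontinuous correction, the sum of the Floquet phases of the periods. -/
lemma exists_phase (h : PeriodicLimit p a₀ b₀ a b) (r : ℕ) {α β : ℝ} (hαβ : α ≤ β)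
    (hK : Icc α β ⊆ ellipticSet (discPoly a₀ b₀ p)) (N₀ : ℕ) :
    ∃ N ≥ N₀, ∃ η : ℕ → ℝ → ℝ, (∀ k ≥ N, ContinuousOn (η k) (Icc α β)) ∧
      (∃ M, ∀ k ≥ N, ∀ E ∈ Icc α β, |η k E| ≤ M) ∧
      (∀ ε > 0, ∃ δ > 0, ∃ N', ∀ k ≥ N', ∀ E ∈ Icc α β, ∀ E' ∈ Icc α β, |E - E'| < δ →
        |η k E - η k E'| < ε) ∧
      ∀ k ≥ N, ∀ E ∈ Icc α β,
        ((orthoPoly a b (k * p + r)).eval E = 0 ↔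
          Real.sin (∑ j ∈ Finset.Ico N k, phase (periodTrace a b p r j) E + η k E) = 0) ∧
        ((orthoPoly a b (k * p + r)).eval E = 0 → 0 < (secondPoly a b (k * p + r)).eval E *
          Real.cos (∑ j ∈ Finset.Ico N k, phase (periodTrace a b p r j) E + η k E)) := by
  set D := discPoly a₀ b₀ p with hD
  set R := max |α| |β| with hR
  have hRK : ∀ E ∈ Icc α β, |E| ≤ R := fun E hE => abs_le_max_of_mem_Icc hE
  obtain ⟨τ, hτ0, hτ2, hτ⟩ := exists_trace_bound hK
  -- the limiting off-diagonal entry does not vanish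
  obtain ⟨δ, hδ, hδB⟩ : ∃ δ > 0, ∀ E ∈ Icc α β, 2 * δ ≤ |(blockPoly a₀ b₀ r p 0 1).eval E| := by
    obtain ⟨E₀, hE₀, hmin⟩ := isCompact_Icc.exists_isMinOn (nonempty_Icc.2 hαβ)
      (f := fun E => |(blockPoly a₀ b₀ r p 0 1).eval E|) (by fun_prop)
    -- If the off-diagonal entry vanished, the diagonal entries would have product one and `(A + D)²
    -- = (A - D)² + 4 ≥ 4`, against ellipticity. Half the minimum leaves room for the perturbed
    -- blocks.
    refine ⟨|(blockPoly a₀ b₀ r p 0 1).eval E₀| / 2, half_pos (abs_pos.2 fun h0 => ?_),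
      fun E hE => by rw [mul_div_cancel₀ _ two_ne_zero]; exact hmin hE⟩
    have h1 := congrArg (eval E₀) (blockPoly_det (b := b₀) (fun n _ => h.ha₀ n) r p)
    have h2 := four_sub_sq_pos (hK hE₀)
    rw [hD, discPoly, ← blockPoly_trace_periodic h.hp h.ha₀p h.hb₀p r] at h2
    simp only [Matrix.det_fin_two, Matrix.trace_fin_two, eval_sub, eval_mul, eval_add, eval_one,
      h0, zero_mul, sub_zero] at h1 h2
    nlinarith [sq_nonneg ((blockPoly a₀ b₀ r p 0 0).eval E₀ - (blockPoly a₀ b₀ r p 1 1).eval E₀)]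
  obtain ⟨M₁, hM₁⟩ := isCompact_Icc.exists_bound_of_continuousOn (s := Icc α β)
    (f := fun E => (blockPoly a₀ b₀ r p 0 1).eval E) (by fun_prop)
  obtain ⟨M₂, hM₂⟩ := isCompact_Icc.exists_bound_of_continuousOn (s := Icc α β)
    (f := fun E => (blockPoly a₀ b₀ r p 1 1).eval E) (by fun_prop)
  have hev : ∀ᶠ j in atTop, ∀ E ∈ Icc α β,
      |(periodTrace a b p r j).eval E| ≤ (τ + 2) / 2 ∧
      δ ≤ |(blockPoly a b (j * p + r) p 0 1).eval E| ∧
      |(blockPoly a b (j * p + r) p 0 1).eval E| ≤ max M₁ M₂ + δ ∧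
      |(blockPoly a b (j * p + r) p 1 1).eval E| ≤ max M₁ M₂ + δ := by
    filter_upwards [h.eventually_trace r R (show 0 < (2 - τ) / 2 by linarith),
      (h.tendsto_index r).eventually ((h.asymp p 0 1).eventually_eval R hδ),
      (h.tendsto_index r).eventually ((h.asymp p 1 1).eventually_eval R hδ)] with j h1 h2 h3 E hE
    have h1 := h1 E (hRK E hE)
    have h2 := h2 E (hRK E hE)
    have h3 := h3 E (hRK E hE)
    rw [h.block_period] at h2 h3
    have t1 := abs_sub_abs_le_abs_sub ((periodTrace a b p r j).eval E) (D.eval E)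
    have t2 := abs_sub_abs_le_abs_sub ((blockPoly a b (j * p + r) p 0 1).eval E)
      ((blockPoly a₀ b₀ r p 0 1).eval E)
    have t2' := abs_sub_abs_le_abs_sub ((blockPoly a₀ b₀ r p 0 1).eval E)
      ((blockPoly a b (j * p + r) p 0 1).eval E)
    rw [abs_sub_comm] at t2'
    have t3 := abs_sub_abs_le_abs_sub ((blockPoly a b (j * p + r) p 1 1).eval E)
      ((blockPoly a₀ b₀ r p 1 1).eval E)
    have u1 := hM₁ E hE
    have u2 := hM₂ E hE
    rw [Real.norm_eq_abs] at u1 u2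
    have := hδB E hE
    have := hτ E hE
    have := le_max_left M₁ M₂
    have := le_max_right M₁ M₂
    exact ⟨by linarith, by linarith, by linarith, by linarith⟩
  obtain ⟨N₁, hN₁⟩ := eventually_atTop.1 hev
  -- All estimates hold from `L` on, so the elliptic lemma is applied to the sequence shifted by `L`
  -- periods and its output is shifted back.
  set L := max N₀ N₁ with hL
  have hLN : ∀ k, N₁ ≤ k + L := fun k => (le_max_right _ _).trans (Nat.le_add_left _ _)
  obtain ⟨cA, hcA, hvA⟩ := (h.asymp p 0 0).exists_summable_eval R
  obtain ⟨cB, hcB, hvB⟩ := (h.asymp p 0 1).exists_summable_eval R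
  obtain ⟨cD, hcD, hvD⟩ := (h.asymp p 1 1).exists_summable_eval R
  have hcA0 : ∀ n, 0 ≤ cA n := fun n => (abs_nonneg _).trans (hvA n α (hRK α (left_mem_Icc.2 hαβ)))
  have hcB0 : ∀ n, 0 ≤ cB n := fun n => (abs_nonneg _).trans (hvB n α (hRK α (left_mem_Icc.2 hαβ)))
  have hcD0 : ∀ n, 0 ≤ cD n := fun n => (abs_nonneg _).trans (hvD n α (hRK α (left_mem_Icc.2 hαβ)))
  have hinj : Function.Injective fun k : ℕ => (k + L) * p + r := fun k k' hk => by
    have := Nat.eq_of_mul_eq_mul_right h.hp (Nat.add_right_cancel hk)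
    omega
  have hidx : ∀ k, (k + 1 + L) * p + r = (k + L) * p + r + p := fun k => by ring
  obtain ⟨N, η, h1, ⟨M, h2⟩, h3, h4⟩ := exists_phase_of_elliptic hαβ
    (x := fun k E => (orthoPoly a b ((k + L) * p + r)).eval E)
    (y := fun k E => (secondPoly a b ((k + L) * p + r)).eval E)
    (A := fun k E => (blockPoly a b ((k + L) * p + r) p 0 0).eval E)
    (B := fun k E => (blockPoly a b ((k + L) * p + r) p 0 1).eval E)
    (C := fun k E => (blockPoly a b ((k + L) * p + r) p 1 0).eval E)
    (D := fun k E => (blockPoly a b ((k + L) * p + r) p 1 1).eval E)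
    (c := fun k => cA ((k + L) * p + r) + cB ((k + L) * p + r) + cD ((k + L) * p + r))
    (δ := δ) (τ := (τ + 2) / 2) (M := max M₁ M₂ + δ) hδ (by linarith) (by linarith)
    (((hcA.comp_injective hinj).add (hcB.comp_injective hinj)).add (hcD.comp_injective hinj))
    (fun k => by fun_prop) (fun k => by fun_prop) (fun k => by fun_prop) (fun k => by fun_prop)
    (fun k => by fun_prop) (fun k E _ => h.eval_ne_zero E _)
    (fun k E _ => by
      have := congrArg (eval E) (blockPoly_det (b := b) h.ha ((k + L) * p + r) p)
      simpa [Matrix.det_fin_two] using this)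
    (fun k E hE => by
      have := (hN₁ _ (hLN k) E hE).1
      rwa [periodTrace, Matrix.trace_fin_two, eval_add] at this)
    (fun k E hE => (hN₁ _ (hLN k) E hE).2.1) (fun k E hE => (hN₁ _ (hLN k) E hE).2.2.1)
    (fun k E hE => (hN₁ _ (hLN k) E hE).2.2.2)
    (fun k E hE => by
      rw [hidx]
      linarith [hvA ((k + L) * p + r) E (hRK E hE), hcB0 ((k + L) * p + r),
        hcD0 ((k + L) * p + r)])
    (fun k E hE => by
      rw [hidx]
      linarith [hvB ((k + L) * p + r) E (hRK E hE), hcA0 ((k + L) * p + r),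
        hcD0 ((k + L) * p + r)])
    (fun k E hE => by
      rw [hidx]
      linarith [hvD ((k + L) * p + r) E (hRK E hE), hcA0 ((k + L) * p + r),
        hcB0 ((k + L) * p + r)])
    (fun k E _ => by rw [hidx, (orthoPoly_add a b _ p).1]; simp)
    (fun k E _ => by rw [hidx, (orthoPoly_add a b _ p).2]; simp)
  refine ⟨N + L, (le_max_left _ _).trans (Nat.le_add_left _ _), fun k => η (k - L),
    fun k hk => h1 _ (by omega), ⟨M, fun k hk => h2 _ (by omega)⟩, ?_, ?_⟩
  · intro ε hε
    obtain ⟨δ', hδ', N', hN'⟩ := h3 ε hε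
    exact ⟨δ', hδ', N' + L, fun k hk => hN' _ (by omega)⟩
  · intro k hk E hE
    obtain ⟨k, rfl⟩ : ∃ k', k = k' + L := ⟨k - L, by omega⟩
    have h5 := h4 k (by omega) E hE
    have h6 : ∑ j ∈ Finset.Ico (N + L) (k + L), phase (periodTrace a b p r j) E =
        ∑ j ∈ Finset.Ico N k, Real.arccos (((blockPoly a b ((j + L) * p + r) p 0 0).eval E +
          (blockPoly a b ((j + L) * p + r) p 1 1).eval E) / 2) := by
      rw [← Finset.sum_Ico_add']
      refine Finset.sum_congr rfl fun j _ => ?_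
      rw [phase, periodTrace, Matrix.trace_fin_two, eval_add]
    simp only [h6, Nat.add_sub_cancel]
    exact h5

end PeriodicLimit

/-! ### Spacing and counting of the zeros -/

lemma cesaro_uniform {K : Set ℝ} {g : ℕ → ℝ → ℝ} {g₀ : ℝ → ℝ} {N : ℕ} {M : ℝ} (hM : 0 ≤ M)
    (hg₀ : ∀ E ∈ K, |g₀ E| ≤ M) (hg : ∀ j ≥ N, ∀ E ∈ K, |g j E - g₀ E| ≤ M)
    (hconv : ∀ ε > 0, ∀ᶠ j in atTop, ∀ E ∈ K, |g j E - g₀ E| < ε) {ε : ℝ} (hε : 0 < ε) :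
    ∀ᶠ k : ℕ in atTop, ∀ E ∈ K, |∑ j ∈ Finset.Ico N k, g j E - k * g₀ E| ≤ ε * k := by
  obtain ⟨N₁, hN₁⟩ := eventually_atTop.1 (hconv (ε / 2) (half_pos hε))
  set N₂ := max N N₁ with hN₂
  have hlarge : ∀ᶠ k : ℕ in atTop, 2 * (N₂ * M) * 2 / ε ≤ (k : ℝ) :=
    tendsto_natCast_atTop_atTop.eventually (eventually_ge_atTop _)
  filter_upwards [hlarge, eventually_ge_atTop N₂] with k hk hkN E hE
  have hNk : N ≤ k := (le_max_left _ _).trans hkN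
  -- The sum has `k - N` terms but is compared with `k` copies of `g₀`; the last term `N * g₀ E`
  -- pays for the difference.
  have e : ∑ j ∈ Finset.Ico N k, g j E - k * g₀ E =
      ∑ j ∈ Finset.Ico N N₂, (g j E - g₀ E) + ∑ j ∈ Finset.Ico N₂ k, (g j E - g₀ E) -
        N * g₀ E := by
    rw [Finset.sum_Ico_consecutive _ (le_max_left _ _) hkN, Finset.sum_sub_distrib,
      Finset.sum_const, Nat.card_Ico, nsmul_eq_mul, Nat.cast_sub hNk]
    ring
  have b1 : |∑ j ∈ Finset.Ico N N₂, (g j E - g₀ E)| ≤ ((N₂ : ℝ) - N) * M := by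
    refine (Finset.abs_sum_le_sum_abs _ _).trans ?_
    refine (Finset.sum_le_card_nsmul _ _ M fun j hj => hg j (Finset.mem_Ico.1 hj).1 E hE).trans ?_
    rw [Nat.card_Ico, nsmul_eq_mul, Nat.cast_sub (le_max_left _ _)]
  have b2 : |∑ j ∈ Finset.Ico N₂ k, (g j E - g₀ E)| ≤ k * (ε / 2) := by
    refine (Finset.abs_sum_le_sum_abs _ _).trans ?_
    refine (Finset.sum_le_card_nsmul _ _ (ε / 2) fun j hj =>
      (hN₁ j ((le_max_right _ _).trans (Finset.mem_Ico.1 hj).1) E hE).le).trans ?_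
    rw [Nat.card_Ico, nsmul_eq_mul, Nat.cast_sub hkN]
    have : (0 : ℝ) ≤ N₂ := Nat.cast_nonneg _
    nlinarith
  have b3 : |(N : ℝ) * g₀ E| ≤ N * M := by
    rw [abs_mul, abs_of_nonneg (Nat.cast_nonneg N)]
    exact mul_le_mul_of_nonneg_left (hg₀ E hE) (Nat.cast_nonneg _)
  rw [div_le_iff₀ hε] at hk
  have hN₂M : 0 ≤ N₂ * M := by positivity
  rw [e]
  have t1 := abs_sub (∑ j ∈ Finset.Ico N N₂, (g j E - g₀ E) +
    ∑ j ∈ Finset.Ico N₂ k, (g j E - g₀ E)) (N * g₀ E)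
  have t2 := abs_add_le (∑ j ∈ Finset.Ico N N₂, (g j E - g₀ E))
    (∑ j ∈ Finset.Ico N₂ k, (g j E - g₀ E))
  nlinarith

lemma eventually_of_residues {P : ℕ → Prop} {p : ℕ} (hp : 1 ≤ p)
    (h : ∀ r < p, ∀ᶠ k in atTop, P (k * p + r)) : ∀ᶠ n in atTop, P n := by
  have h1 : ∀ᶠ k in atTop, ∀ r ∈ Finset.range p, P (k * p + r) :=
    (Finset.eventually_all _).2 fun r hr => h r (Finset.mem_range.1 hr)
  obtain ⟨N, hN⟩ := eventually_atTop.1 h1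
  filter_upwards [eventually_ge_atTop (N * p)] with n hn
  have h2 := hN (n / p) ((Nat.le_div_iff_mul_le hp).2 hn) (n % p)
    (Finset.mem_range.2 (Nat.mod_lt _ hp))
  rwa [Nat.div_add_mod'] at h2

/-- At consecutive zeros of a differentiable function the derivatives have opposite signs. -/
lemma deriv_mul_deriv_nonpos {f f' : ℝ → ℝ} (hf : ∀ x, HasDerivAt f (f' x) x) {s t : ℝ}
    (hst : s < t) (hs : f s = 0) (ht : f t = 0) (hne : ∀ x ∈ Ioo s t, f x ≠ 0) :
    f' s * f' t ≤ 0 := by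
  have hc : Continuous f := continuous_iff_continuousAt.2 fun x => (hf x).continuousAt
  have key : ∀ {g g' : ℝ → ℝ}, (∀ x, HasDerivAt g (g' x) x) → g s = 0 → g t = 0 →
      (∀ x ∈ Ioo s t, 0 < g x) → 0 ≤ g' s ∧ g' t ≤ 0 := by
    intro g g' hg hgs hgt hpos
    constructor
    · have h1 := (hasDerivAt_iff_tendsto_slope.1 (hg s)).mono_left
        (nhdsWithin_mono (s := Ioi s) s fun x hx => (mem_Ioi.1 hx).ne')
      refine ge_of_tendsto h1 ?_
      filter_upwards [Ioo_mem_nhdsGT hst] with x hx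
      rw [slope_def_field, hgs, sub_zero]
      exact div_nonneg (hpos x hx).le (by linarith [hx.1])
    · have h1 := (hasDerivAt_iff_tendsto_slope.1 (hg t)).mono_left
        (nhdsWithin_mono (s := Iio t) t fun x hx => (mem_Iio.1 hx).ne)
      refine le_of_tendsto h1 ?_
      filter_upwards [Ioo_mem_nhdsLT hst] with x hx
      rw [slope_def_field, hgt, sub_zero]
      exact div_nonpos_of_nonneg_of_nonpos (hpos x hx).le (by linarith [hx.2])
  have hsign : (∀ x ∈ Ioo s t, 0 < f x) ∨ (∀ x ∈ Ioo s t, 0 < -f x) := by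
    by_contra! hcon
    obtain ⟨⟨x, hx, hfx⟩, ⟨y, hy, hfy⟩⟩ := hcon
    obtain ⟨z, hz, hfz⟩ := isPreconnected_Ioo.intermediate_value hx hy hc.continuousOn
      (show (0 : ℝ) ∈ Icc (f x) (f y) from ⟨hfx, by linarith⟩)
    exact hne z hz hfz
  rcases hsign with h | h
  · obtain ⟨h1, h2⟩ := key hf hs ht h
    exact mul_nonpos_of_nonneg_of_nonpos h1 h2
  · obtain ⟨h1, h2⟩ := key (g := fun x => -f x) (g' := fun x => -f' x) (fun x => (hf x).neg)
      (by simp [hs]) (by simp [ht]) h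
    nlinarith

/-- By Christoffel–Darboux `p_n'` and `secondPoly` have the same nonzero sign at a zero of `p_n`,
and `p_n'` cannot keep its sign from one zero to the next. -/
lemma secondPoly_mul_neg {a : ℕ → ℝ} (b : ℕ → ℝ) (ha : ∀ n, 1 ≤ n → 0 < a n) {n : ℕ}
    {α β E' E : ℝ} (h : SuccessiveZeros a b n α β E' E) :
    (secondPoly a b n).eval E' * (secondPoly a b n).eval E < 0 := by
  obtain ⟨-, -, hlt, h1, h2, h3⟩ := h
  rcases n with _ | n
  · simp [orthoPoly] at h1
  have c1 := christoffelDarboux b ha E' n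
  have c2 := christoffelDarboux b ha E n
  rw [IsRoot] at h1 h2
  rw [h1, zero_mul, sub_zero] at c1
  rw [h2, zero_mul, sub_zero] at c2
  have h4 := deriv_mul_deriv_nonpos (fun x => (orthoPoly a b (n + 1)).hasDerivAt x) hlt h1 h2
    fun x hx => h3 x hx
  by_contra! h5
  have h6 := mul_pos c1 c2
  nlinarith

/-- No multiple of `π` is skipped, by the intermediate value theorem. The cosine condition excludes
a return to the same multiple, which could otherwise happen because `Φ` need not be monotone. -/
lemma abs_phase_sub_eq_pi {Φ : ℝ → ℝ} {s t : ℝ} (hst : s ≤ t) (hΦ : ContinuousOn Φ (Icc s t))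
    (hs : Real.sin (Φ s) = 0) (ht : Real.sin (Φ t) = 0)
    (hne : ∀ x ∈ Ioo s t, Real.sin (Φ x) ≠ 0) (hcos : Real.cos (Φ s) * Real.cos (Φ t) < 0) :
    |Φ t - Φ s| = Real.pi := by
  obtain ⟨m, hm⟩ := Real.sin_eq_zero_iff.1 hs
  obtain ⟨n, hn⟩ := Real.sin_eq_zero_iff.1 ht
  have hpi := Real.pi_pos
  have hmn : m ≠ n := by
    rintro rfl
    rw [← hm, ← hn] at hcos
    exact (mul_self_nonneg _).not_gt hcos
  have hno : ∀ j : ℤ, ¬ ((m < j ∧ j < n) ∨ (n < j ∧ j < m)) := by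
    rintro j (⟨h1, h2⟩ | ⟨h1, h2⟩)
    · obtain ⟨x, hx, hxj⟩ := intermediate_value_Ioo hst hΦ (show (j : ℝ) * Real.pi ∈ Ioo _ _ from by
        rw [← hm, ← hn]
        constructor <;> gcongr)
      exact hne x hx (by rw [hxj]; exact Real.sin_int_mul_pi j)
    · obtain ⟨x, hx, hxj⟩ := intermediate_value_Ioo' hst hΦ (show (j : ℝ) * Real.pi ∈ Ioo _ _ from by
        rw [← hm, ← hn]
        constructor <;> gcongr)
      exact hne x hx (by rw [hxj]; exact Real.sin_int_mul_pi j)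
  rw [← hm, ← hn]
  rcases lt_or_gt_of_ne hmn with h | h
  · have : n = m + 1 := by
      have := hno (m + 1)
      omega
    rw [this]; push_cast
    rw [show ((m : ℝ) + 1) * Real.pi - m * Real.pi = Real.pi by ring, abs_of_pos hpi]
  · have : m = n + 1 := by
      have := hno (n + 1)
      omega
    rw [this]; push_cast
    rw [show (n : ℝ) * Real.pi - ((n : ℝ) + 1) * Real.pi = -Real.pi by ring, abs_neg,
      abs_of_pos hpi]

/-- A continuous phase that changes by `c` passes at least `|c| / π - 1` multiples of `π`. -/
lemma phase_sub_le_card {Φ : ℝ → ℝ} {s t : ℝ} (hst : s ≤ t) (hΦ : ContinuousOn Φ (Icc s t))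
    {F : Finset ℝ} (hF : ∀ x ∈ Ioo s t, Real.sin (Φ x) = 0 → x ∈ F) :
    |Φ t - Φ s| / Real.pi - 1 ≤ F.card := by
  have hpi := Real.pi_pos
  have key : ∀ {u v : ℝ}, (∀ j : ℤ, (j : ℝ) * Real.pi ∈ Ioo u v →
      ∃ x ∈ Ioo s t, Φ x = j * Real.pi) → (v - u) / Real.pi - 1 ≤ F.card := by
    intro u v huv
    -- The integers `j` with `u < jπ < v`, both inequalities strict.
    set Z := Finset.Icc (⌊u / Real.pi⌋ + 1) (⌈v / Real.pi⌉ - 1) with hZ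
    have hmem : ∀ j ∈ Z, (j : ℝ) * Real.pi ∈ Ioo u v := by
      intro j hj
      rw [hZ, Finset.mem_Icc] at hj
      constructor
      · rw [← div_lt_iff₀ hpi]; exact Int.floor_lt.1 (by omega)
      · rw [← lt_div_iff₀ hpi]; exact Int.lt_ceil.1 (by omega)
    choose! ξ hξ using fun j (hj : j ∈ Z) => huv j (hmem j hj)
    have hcard : Z.card ≤ F.card := by
      refine Finset.card_le_card_of_injOn ξ (fun j hj => ?_) ?_
      · exact hF _ (hξ j hj).1 (by rw [(hξ j hj).2]; exact Real.sin_int_mul_pi j)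
      · intro j hj j' hj' hjj
        have h1 := (hξ j hj).2
        rw [hjj, (hξ j' hj').2] at h1
        exact_mod_cast (mul_right_cancel₀ hpi.ne' h1).symm
    have hZc : (v - u) / Real.pi - 1 ≤ Z.card := by
      rw [hZ, Int.card_Icc]
      have h1 : v / Real.pi ≤ ⌈v / Real.pi⌉ := Int.le_ceil _
      have h2 : (⌊u / Real.pi⌋ : ℝ) ≤ u / Real.pi := Int.floor_le _
      have h3 : (((⌈v / Real.pi⌉ - 1 + 1 - (⌊u / Real.pi⌋ + 1) : ℤ)) : ℝ) ≤
          (((⌈v / Real.pi⌉ - 1 + 1 - (⌊u / Real.pi⌋ + 1) : ℤ).toNat : ℕ) : ℝ) := by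
        exact_mod_cast Int.self_le_toNat _
      push_cast at h3
      rw [sub_div]
      linarith
    exact hZc.trans (by exact_mod_cast hcard)
  rcases le_total (Φ s) (Φ t) with h | h
  · rw [abs_of_nonneg (sub_nonneg.2 h)]
    refine key fun j hj => ?_
    obtain ⟨x, hx, hxj⟩ := intermediate_value_Ioo hst hΦ hj
    exact ⟨x, hx, hxj⟩
  · rw [abs_sub_comm, abs_of_nonneg (sub_nonneg.2 h)]
    refine key fun j hj => ?_
    obtain ⟨x, hx, hxj⟩ := intermediate_value_Ioo' hst hΦ hj
    exact ⟨x, hx, hxj⟩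

/-- The a priori estimate. Here `d` is the spacing, `t` the absolute derivative of the phase sum at
an intermediate point, `u` its limit per period, `m` a lower bound for `u`, and `M` the bound on
`η`. -/
lemma spacing_bound {k d t u m e M : ℝ} (hm : 0 < m) (hk : 0 < k) (hd : 0 < d) (he : e ≤ m / 2)
    (hu : m ≤ u) (htk : |t - k * u| ≤ e * k) (htd : |t * d - Real.pi| ≤ 2 * M) :
    k * d ≤ 2 * (Real.pi + 2 * M) / m := by
  have h1 := (abs_le.1 htk).1
  have h2 := mul_le_mul_of_nonneg_left hu hk.le
  have h3 := mul_le_mul_of_nonneg_right he hk.le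
  have h4 : k * (m / 2) ≤ t := by linarith
  have h5 := mul_le_mul_of_nonneg_right h4 hd.le
  have h6 := (abs_le.1 htd).2
  rw [le_div_iff₀ hm]
  linarith

lemma spacing_estimate {k d t u v m e e' M p r ε : ℝ} (hp : 0 < p) (hm : 0 < m) (hk : 0 < k)
    (hd : 0 < d) (he0 : 0 ≤ e) (hr : 0 ≤ r) (hv : m ≤ v) (htk : |t - k * u| ≤ e * k)
    (htd : |t * d - Real.pi| ≤ e') (huv : |u - v| ≤ e) (hkd : k * d ≤ M)
    (he : 2 * e * M * (p / m) ≤ ε / 4) (he' : e' * (p / m) ≤ ε / 4) (hrM : r * M * 4 ≤ k * ε) :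
    |(k * p + r) * d - (v / (Real.pi * p))⁻¹| ≤ ε := by
  have hkd0 : 0 < k * d := mul_pos hk hd
  have hpi := Real.pi_pos
  have hv0 : 0 < v := hm.trans_le hv
  have hmain : |k * v * d - Real.pi| ≤ e' + 2 * e * M := by
    -- Three errors: the variation of `η`, the Cesàro error at the mean value point, and the move
    -- from that point to the evaluation point.
    rw [show k * v * d - Real.pi = (t * d - Real.pi) - (t - k * u) * d - (u - v) * (k * d) by ring]
    refine (abs_sub _ _).trans ?_
    refine (add_le_add_left (abs_sub _ _) _).trans ?_
    rw [abs_mul, abs_mul, abs_of_pos hd, abs_of_pos hkd0]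
    have h2 := mul_le_mul_of_nonneg_right htk hd.le
    have h3 := mul_le_mul_of_nonneg_right huv hkd0.le
    have h4 := mul_le_mul_of_nonneg_left hkd he0
    linarith
  rw [show (k * p + r) * d - (v / (Real.pi * p))⁻¹ =
    (p / v) * (k * v * d - Real.pi) + r * d by field_simp; ring]
  refine (abs_add_le _ _).trans ?_
  rw [abs_mul, abs_of_pos (div_pos hp hv0), abs_of_nonneg (mul_nonneg hr hd.le)]
  have h5 : p / v * |k * v * d - Real.pi| ≤ (p / m) * (e' + 2 * e * M) :=
    mul_le_mul (div_le_div_of_nonneg_left hp.le hm hv) hmain (abs_nonneg _) (by positivity)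
  have h6 : r * d ≤ ε / 4 := by
    have h7 : r * (k * d) ≤ r * M := mul_le_mul_of_nonneg_left hkd hr
    have h8 : k * (r * d) ≤ k * (ε / 4) := by linarith
    exact le_of_mul_le_mul_left h8 hk
  have h9 : 0 ≤ r * d := mul_nonneg hr hd.le
  linarith

/-! ### Clock behavior and zero counting along residue classes -/

namespace PeriodicLimit

variable {p : ℕ} {a₀ b₀ a b : ℕ → ℝ}

lemma clock_residue (h : PeriodicLimit p a₀ b₀ a b) (r : ℕ) {α β : ℝ} (hαβ : α ≤ β)
    (hK : Icc α β ⊆ ellipticSet (discPoly a₀ b₀ p)) {ε : ℝ} (hε : 0 < ε) :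
    ∀ᶠ k : ℕ in atTop, ∀ E' E, SuccessiveZeros a b (k * p + r) α β E' E → ∀ x ∈ Icc E' E,
      |((k * p + r : ℕ) : ℝ) * (E - E') -
        (|phaseDeriv (discPoly a₀ b₀ p) x| / (Real.pi * p))⁻¹| ≤ ε := by
  set g := phaseDeriv (discPoly a₀ b₀ p) with hg
  have hgc : ContinuousOn g (Icc α β) := (continuousOn_phaseDeriv _).mono hK
  have hpR : (0 : ℝ) < p := by exact_mod_cast h.hp
  have hpi := Real.pi_pos
  obtain ⟨m, hm, hmg⟩ : ∃ m > 0, ∀ E ∈ Icc α β, m ≤ |g E| := by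
    obtain ⟨E₀, hE₀, hmin⟩ := isCompact_Icc.exists_isMinOn (nonempty_Icc.2 hαβ) hgc.abs
    exact ⟨|g E₀|, abs_pos.2 (phaseDeriv_ne_zero b₀ (fun n _ => h.ha₀ n) h.hp (hK hE₀)),
      fun E hE => hmin hE⟩
  obtain ⟨G, hG⟩ := isCompact_Icc.exists_bound_of_continuousOn hgc
  have hG0 : 0 ≤ G := (norm_nonneg _).trans (hG α (left_mem_Icc.2 hαβ))
  obtain ⟨N₀, hN₀⟩ := eventually_atTop.1
    ((h.eventually_elliptic r hK).and (h.eventually_phaseDeriv r hK one_pos))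
  obtain ⟨N, hNN₀, η, hηc, ⟨M, hM⟩, hηe, hzero⟩ := h.exists_phase r hαβ hK N₀
  have hM0 : 0 ≤ M := (abs_nonneg _).trans (hM N le_rfl α (left_mem_Icc.2 hαβ))
  -- an a priori bound `h ≤ C₁ / k` on the spacing, and the tolerances
  set C₁ := 2 * (Real.pi + 2 * M) / m with hC₁
  have hC₁0 : 0 < C₁ := by positivity
  -- `m / 2` is what the a priori bound needs; the other value makes the Cesàro and evaluation
  -- errors together at most `ε / 4` after multiplication by `p / m`.
  set ε₁ := min (m / 2) (ε * m / (8 * C₁ * p)) with hε₁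
  have hε₁0 : 0 < ε₁ := lt_min (by positivity) (by positivity)
  have hε₁m : ε₁ ≤ m / 2 := min_le_left _ _
  have hε₁' : 2 * ε₁ * C₁ * (p / m) ≤ ε / 4 := by
    have : ε₁ ≤ ε * m / (8 * C₁ * p) := min_le_right _ _
    rw [le_div_iff₀ (by positivity)] at this
    rw [← mul_div_assoc, div_le_iff₀ hm]
    linarith
  set ε₂ := ε * m / (4 * p) with hε₂
  have hε₂0 : 0 < ε₂ := by positivity
  have hε₂' : ε₂ * (p / m) = ε / 4 := by rw [hε₂]; field_simp
  obtain ⟨δ₁, hδ₁, N₁, hN₁⟩ := hηe ε₂ hε₂0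
  obtain ⟨δ₂, hδ₂, hgu⟩ := Metric.uniformContinuousOn_iff.1
    (isCompact_Icc.uniformContinuousOn_of_continuous hgc) ε₁ hε₁0
  have hces := cesaro_uniform (K := Icc α β) (N := N)
    (g := fun j => phaseDeriv (periodTrace a b p r j)) (g₀ := g) (M := G + 1) (by linarith)
    (fun E hE => by have := hG E hE; rw [Real.norm_eq_abs] at this; linarith)
    (fun j hj E hE => by have := (hN₀ j (hNN₀.trans hj)).2 E hE; linarith)
    (fun ε hε => h.eventually_phaseDeriv r hK hε) hε₁0
  have hk1 : ∀ᶠ k : ℕ in atTop, C₁ / min δ₁ δ₂ < (k : ℝ) :=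
    tendsto_natCast_atTop_atTop.eventually (eventually_gt_atTop _)
  have hk2 : ∀ᶠ k : ℕ in atTop, r * C₁ * 4 / ε < (k : ℝ) :=
    tendsto_natCast_atTop_atTop.eventually (eventually_gt_atTop _)
  filter_upwards [hces, hk1, hk2, eventually_ge_atTop N, eventually_ge_atTop N₁,
    eventually_gt_atTop 0] with k hS hk1 hk2 hkN hkN₁ hk0 E' E hsz x hx
  have hkR : (0 : ℝ) < k := by exact_mod_cast hk0
  have hsz' := hsz
  obtain ⟨hE', hE, hlt, hz', hz, hbet⟩ := hsz'
  have hsub : Icc E' E ⊆ Icc α β := Icc_subset_Icc hE'.1 hE.2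
  set S : ℝ → ℝ := fun y => ∑ j ∈ Finset.Ico N k, phase (periodTrace a b p r j) y with hSdef
  have hSd : ∀ y ∈ Icc α β,
      HasDerivAt S (∑ j ∈ Finset.Ico N k, phaseDeriv (periodTrace a b p r j) y) y := by
    intro y hy
    exact HasDerivAt.fun_sum fun j hj =>
      hasDerivAt_phase ((hN₀ j (hNN₀.trans (Finset.mem_Ico.1 hj).1)).1 hy)
  have hSc : ContinuousOn S (Icc α β) := fun y hy => (hSd y hy).continuousAt.continuousWithinAt
  have hπ : |(S E + η k E) - (S E' + η k E')| = Real.pi := by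
    refine abs_phase_sub_eq_pi (Φ := fun y => S y + η k y) hlt.le
      ((hSc.add (hηc k hkN)).mono hsub) ((hzero k hkN E' hE').1.1 hz') ((hzero k hkN E hE).1.1 hz)
      (fun y hy h0 => hbet y hy
        ((hzero k hkN y (hsub (Ioo_subset_Icc_self hy))).1.2 h0)) ?_
    have h1 := (hzero k hkN E' hE').2 hz'
    have h2 := (hzero k hkN E hE).2 hz
    have h3 := secondPoly_mul_neg b h.ha hsz
    by_contra! h4
    change 0 ≤ Real.cos (S E' + η k E') * Real.cos (S E + η k E) at h4
    have h5 := mul_pos h1 h2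
    change 0 < _ * Real.cos (S E' + η k E') * (_ * Real.cos (S E + η k E)) at h5
    nlinarith
  -- The mean value theorem is applied to the phase sum only: `η` is merely continuous and enters
  -- through its increment.
  obtain ⟨ξ, hξ, hξS⟩ := exists_hasDerivAt_eq_slope S
    (fun y => ∑ j ∈ Finset.Ico N k, phaseDeriv (periodTrace a b p r j) y) hlt (hSc.mono hsub)
    fun y hy => hSd y (hsub (Ioo_subset_Icc_self hy))
  have hξK := hsub (Ioo_subset_Icc_self hξ)
  have hxK := hsub hx
  have hSξ := hS ξ hξK
  set T := ∑ j ∈ Finset.Ico N k, phaseDeriv (periodTrace a b p r j) ξ with hT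
  set d := E - E' with hd
  have hd0 : 0 < d := sub_pos.2 hlt
  have hTd : S E - S E' = T * d := by
    rw [hξS, div_mul_cancel₀ _ hd0.ne']
  have hTdπ : |(|T| * d - Real.pi)| ≤ |η k E - η k E'| := by
    have h1 : |T| * d = |S E - S E'| := by rw [hTd, abs_mul, abs_of_pos hd0]
    rw [h1, ← hπ]
    refine (abs_abs_sub_abs_le _ _).trans ?_
    rw [← abs_neg]
    apply le_of_eq
    congr 1
    ring
  have hkg : |(k : ℝ) * g ξ| = k * |g ξ| := by rw [abs_mul, abs_of_pos hkR]
  have hTk : |(|T| - k * |g ξ|)| ≤ ε₁ * k := by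
    rw [← hkg]
    exact (abs_abs_sub_abs_le _ _).trans hSξ
  -- First pass, using only `|η| ≤ M`. It forces the spacing below `δ₁` and `δ₂`, and then the
  -- equicontinuity of `η` and the uniform continuity of `g` apply.
  have hkd : k * d ≤ C₁ := by
    have h1 : |η k E - η k E'| ≤ 2 * M := by
      refine (abs_sub _ _).trans ?_
      linarith [hM k hkN E hE, hM k hkN E' hE']
    exact spacing_bound hm hkR hd0 hε₁m (hmg ξ hξK) hTk (hTdπ.trans h1)
  have hdδ : d < min δ₁ δ₂ := by
    rw [div_lt_iff₀ (lt_min hδ₁ hδ₂)] at hk1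
    by_contra! h1
    have := mul_le_mul_of_nonneg_left h1 hkR.le
    linarith
  have hη : |η k E - η k E'| < ε₂ := hN₁ k hkN₁ E hE E' hE' (by
    rw [← hd, abs_of_pos hd0]; exact hdδ.trans_le (min_le_left _ _))
  have hgx : |g ξ - g x| < ε₁ := hgu ξ hξK x hxK (by
    rw [Real.dist_eq, abs_lt]
    have := min_le_right δ₁ δ₂
    constructor <;> linarith [hξ.1, hξ.2, hx.1, hx.2])
  have hgx' : |(|g ξ| - |g x|)| ≤ ε₁ := (abs_abs_sub_abs_le _ _).trans hgx.le
  rw [div_lt_iff₀ hε] at hk2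
  push_cast
  exact spacing_estimate hpR hm hkR hd0 hε₁0.le (Nat.cast_nonneg r) (hmg x hxK) hTk
    (hTdπ.trans hη.le) hgx' hkd hε₁' hε₂'.le hk2.le

lemma clock (h : PeriodicLimit p a₀ b₀ a b) {α β : ℝ} (hαβ : α ≤ β)
    (hK : Icc α β ⊆ ellipticSet (discPoly a₀ b₀ p)) {ε : ℝ} (hε : 0 < ε) :
    ∀ᶠ n : ℕ in atTop, ∀ E' E, SuccessiveZeros a b n α β E' E → ∀ x ∈ Icc E' E,
      |(n : ℝ) * (E - E') - (|phaseDeriv (discPoly a₀ b₀ p) x| / (Real.pi * p))⁻¹| ≤ ε :=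
  eventually_of_residues h.hp fun r _ => h.clock_residue r hαβ hK hε

lemma count_residue (h : PeriodicLimit p a₀ b₀ a b) (r : ℕ) (hr : r ≤ p) {s t : ℝ} (hst : s ≤ t)
    (hK : Icc s t ⊆ ellipticSet (discPoly a₀ b₀ p)) {ε : ℝ} (hε : 0 < ε) :
    ∀ᶠ k : ℕ in atTop, ((k * p + r : ℕ) : ℝ) *
      (|phase (discPoly a₀ b₀ p) t - phase (discPoly a₀ b₀ p) s| / (Real.pi * p) - ε) ≤
      (((orthoPoly a b (k * p + r)).roots.toFinset.filter (· ∈ Ioo s t)).card : ℝ) := by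
  set θ := phase (discPoly a₀ b₀ p) with hθ
  have hpR : (0 : ℝ) < p := by exact_mod_cast h.hp
  have hp1 : (1 : ℝ) ≤ p := by exact_mod_cast h.hp
  have hpi := Real.pi_pos
  obtain ⟨N, -, η, hηc, ⟨M, hM⟩, -, hzero⟩ := h.exists_phase r hst hK 0
  -- Counting needs the phase sums only at the two endpoints, so Cesàro averaging is used on
  -- singletons.
  have hces : ∀ E, ∀ᶠ k : ℕ in atTop,
      |∑ j ∈ Finset.Ico N k, phase (periodTrace a b p r j) E - k * θ E| ≤ ε / 2 * k := by
    intro E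
    have hb : ∀ D : ℝ[X], |phase D E| ≤ Real.pi := fun D => by
      rw [phase, abs_of_nonneg (Real.arccos_nonneg _)]; exact Real.arccos_le_pi _
    have h1 := cesaro_uniform (K := {E}) (N := N) (g := fun j => phase (periodTrace a b p r j))
      (g₀ := θ) (M := 2 * Real.pi) (by linarith)
      (fun x hx => by rw [mem_singleton_iff.1 hx]; linarith [hb (discPoly a₀ b₀ p)])
      (fun j _ x hx => by
        rw [mem_singleton_iff.1 hx]
        refine (abs_sub _ _).trans ?_
        linarith [hb (discPoly a₀ b₀ p), hb (periodTrace a b p r j)])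
      (fun ε hε => by
        filter_upwards [Metric.tendsto_nhds.1 (h.tendsto_phase r E) ε hε] with j hj x hx
        rw [mem_singleton_iff.1 hx]
        exact hj) (half_pos hε)
    filter_upwards [h1] with k hk using hk E rfl
  set c := |θ t - θ s| with hc
  have hlarge : ∀ᶠ k : ℕ in atTop, ((2 * M) / Real.pi + 1 + c / Real.pi) * 2 / ε ≤ (k : ℝ) :=
    tendsto_natCast_atTop_atTop.eventually (eventually_ge_atTop _)
  filter_upwards [hces s, hces t, hlarge, eventually_ge_atTop N] with k hs ht hk hkN
  set S : ℝ → ℝ := fun y => ∑ j ∈ Finset.Ico N k, phase (periodTrace a b p r j) y with hS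
  have hSc : Continuous S := continuous_finsetSum _ fun j _ => continuous_phase _
  have h1 := phase_sub_le_card (Φ := fun y => S y + η k y) hst (hSc.continuousOn.add (hηc k hkN))
    (F := (orthoPoly a b (k * p + r)).roots.toFinset.filter (· ∈ Ioo s t)) fun x hx h0 => by
      rw [Finset.mem_filter, Multiset.mem_toFinset, mem_roots (orthoPoly_ne_zero b h.ha _)]
      exact ⟨(hzero k hkN x (Ioo_subset_Icc_self hx)).1.2 h0, hx⟩
  refine le_trans ?_ h1
  have hMs := hM k hkN s (left_mem_Icc.2 hst)
  have hMt := hM k hkN t (right_mem_Icc.2 hst)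
  have hkR : (0 : ℝ) ≤ k := Nat.cast_nonneg k
  have h2 : k * c - ε * k - 2 * M ≤ |(S t + η k t) - (S s + η k s)| := by
    have e : k * (θ t - θ s) = ((S t + η k t) - (S s + η k s)) - (S t - k * θ t) +
        (S s - k * θ s) - (η k t - η k s) := by ring
    have h3 : k * c = |k * (θ t - θ s)| := by rw [abs_mul, abs_of_nonneg hkR]
    have h4 : |k * (θ t - θ s)| ≤ |(S t + η k t) - (S s + η k s)| + |S t - k * θ t| +
        |S s - k * θ s| + (|η k t| + |η k s|) := by
      rw [e]
      refine (abs_sub _ _).trans (add_le_add ((abs_add_le _ _).trans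
        (add_le_add (abs_sub _ _) le_rfl)) (abs_sub _ _))
    linarith
  have h5 : ((k * p + r : ℕ) : ℝ) * (c / (Real.pi * p)) ≤ (k + 1) * (c / Real.pi) := by
    have hrR : (r : ℝ) ≤ p := by exact_mod_cast hr
    have : c / (Real.pi * p) = (c / Real.pi) / p := by field_simp
    rw [this, ← mul_div_assoc, div_le_iff₀ hpR]
    push_cast
    have : 0 ≤ c / Real.pi := div_nonneg (abs_nonneg _) hpi.le
    nlinarith
  have h6 : ε * k ≤ ((k * p + r : ℕ) : ℝ) * ε := by
    push_cast
    have : 0 ≤ (r : ℝ) := Nat.cast_nonneg r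
    nlinarith [mul_le_mul_of_nonneg_left hp1 (mul_nonneg hkR hε.le), mul_nonneg this hε.le]
  have h7 : (k * c - ε * k - 2 * M) / Real.pi ≤
      |(S t + η k t) - (S s + η k s)| / Real.pi := div_le_div_of_nonneg_right h2 hpi.le
  have h8 : ε * k / Real.pi ≤ ε * k / 2 := by
    apply div_le_div_of_nonneg_left (by positivity) (by norm_num) Real.two_le_pi
  rw [div_le_iff₀ hε] at hk
  have e3 : (k * c - ε * k - 2 * M) / Real.pi = k * (c / Real.pi) - ε * k / Real.pi -
      2 * M / Real.pi := by field_simp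
  nlinarith

/-- The number of zeros of `p_n` in a compact subinterval of the bands is asymptotically at least
`n / (π p)` times the variation of the Floquet phase. -/
lemma count (h : PeriodicLimit p a₀ b₀ a b) {s t : ℝ} (hst : s ≤ t)
    (hK : Icc s t ⊆ ellipticSet (discPoly a₀ b₀ p)) {ε : ℝ} (hε : 0 < ε) :
    ∀ᶠ n : ℕ in atTop, (n : ℝ) *
      (|phase (discPoly a₀ b₀ p) t - phase (discPoly a₀ b₀ p) s| / (Real.pi * p) - ε) ≤
      (((orthoPoly a b n).roots.toFinset.filter (· ∈ Ioo s t)).card : ℝ) :=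
  eventually_of_residues h.hp fun r hr => h.count_residue r hr.le hst hK hε

end PeriodicLimit

/-! ### The density of states -/

/-- The density of states of a discriminant `D` of period `p`. -/
noncomputable def densityOfStates (D : ℝ[X]) (p : ℕ) : Measure ℝ :=
  (volume.restrict (ellipticSet D)).withDensity
    fun E => ENNReal.ofReal (|phaseDeriv D E| / (Real.pi * p))

lemma densityOfStates_apply {D : ℝ[X]} {p : ℕ} {A : Set ℝ} (hA : MeasurableSet A)
    (hAS : A ⊆ ellipticSet D) :
    densityOfStates D p A = ∫⁻ E in A, ENNReal.ofReal (|phaseDeriv D E| / (Real.pi * p)) := by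
  rw [densityOfStates, withDensity_apply _ hA, Measure.restrict_restrict hA,
    inter_eq_self_of_subset_left hAS]

lemma densityOfStates_compl {D : ℝ[X]} {p : ℕ} : densityOfStates D p (ellipticSet D)ᶜ = 0 := by
  refine withDensity_absolutelyContinuous _ _ ?_
  rw [Measure.restrict_apply (isOpen_ellipticSet D).measurableSet.compl, compl_inter_self,
    measure_empty]

/-- Rolle's theorem; continuity at the endpoints suffices, so closed bands are included although the
derivative may blow up at their edges. -/
lemma injOn_phase {D : ℝ[X]} (hD : ∀ E ∈ ellipticSet D, phaseDeriv D E ≠ 0) {l u : ℝ}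
    (hlu : Ioo l u ⊆ ellipticSet D) : InjOn (phase D) (Icc l u) := by
  have key : ∀ x ∈ Icc l u, ∀ y ∈ Icc l u, x < y → phase D x ≠ phase D y := by
    intro x hx y hy hxy he
    obtain ⟨c, hc, hc0⟩ := exists_hasDerivAt_eq_zero hxy (continuous_phase D).continuousOn he
      fun z hz => hasDerivAt_phase (hlu ⟨hx.1.trans_lt hz.1, hz.2.trans_le hy.2⟩)
    exact hD c (hlu ⟨hx.1.trans_lt hc.1, hc.2.trans_le hy.2⟩) hc0
  intro x hx y hy he
  rcases lt_trichotomy x y with h | h | h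
  · exact absurd he (key x hx y hy h)
  · exact h
  · exact absurd he.symm (key y hy x hx h)

lemma volume_image_phase {D : ℝ[X]} (hD : ∀ E ∈ ellipticSet D, phaseDeriv D E ≠ 0) {l u : ℝ}
    (h : l ≤ u) (hlu : Ioo l u ⊆ ellipticSet D) :
    volume (phase D '' Ioo l u) = ENNReal.ofReal |phase D u - phase D l| := by
  have hc : ContinuousOn (phase D) (Icc l u) := (continuous_phase D).continuousOn
  have hl := left_mem_Icc.2 h
  have hu := right_mem_Icc.2 h
  rcases hc.strictMonoOn_of_injOn_Icc' h (injOn_phase hD hlu) with hm | hm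
  · have e : phase D '' Ioo l u = Ioo (phase D l) (phase D u) := by
      refine Subset.antisymm ?_ (intermediate_value_Ioo h hc)
      rintro _ ⟨x, hx, rfl⟩
      have hx' := Ioo_subset_Icc_self hx
      exact ⟨hm hl hx' hx.1, hm hx' hu hx.2⟩
    rw [e, Real.volume_Ioo, abs_of_nonneg (sub_nonneg.2 (hm.monotoneOn hl hu h))]
  · have e : phase D '' Ioo l u = Ioo (phase D u) (phase D l) := by
      refine Subset.antisymm ?_ (intermediate_value_Ioo' h hc)
      rintro _ ⟨x, hx, rfl⟩
      have hx' := Ioo_subset_Icc_self hx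
      exact ⟨hm hx' hu hx.2, hm hl hx' hx.1⟩
    rw [e, Real.volume_Ioo, abs_sub_comm,
      abs_of_nonneg (sub_nonneg.2 (hm.antitoneOn hl hu h))]

lemma densityOfStates_Ioo {D : ℝ[X]} (hD : ∀ E ∈ ellipticSet D, phaseDeriv D E ≠ 0) {p : ℕ}
    {l u : ℝ} (h : l ≤ u) (hlu : Ioo l u ⊆ ellipticSet D) :
    densityOfStates D p (Ioo l u) =
      ENNReal.ofReal (|phase D u - phase D l| / (Real.pi * p)) := by
  have h1 := lintegral_image_eq_lintegral_abs_deriv_mul (f := phase D) (f' := phaseDeriv D)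
    measurableSet_Ioo (fun x hx => (hasDerivAt_phase (hlu hx)).hasDerivWithinAt)
    ((injOn_phase hD hlu).mono Ioo_subset_Icc_self) fun _ => ENNReal.ofReal (Real.pi * p)⁻¹
  rw [densityOfStates_apply measurableSet_Ioo hlu]
  simp only [div_eq_mul_inv, ENNReal.ofReal_mul (abs_nonneg _)]
  rw [← h1, lintegral_const, Measure.restrict_apply_univ, volume_image_phase hD h hlu, mul_comm]

/-- Every elliptic energy lies in a band, bounded by two non-elliptic energies. -/
lemma exists_band {D : ℝ[X]} (hdeg : 0 < D.degree) {x : ℝ} (hx : x ∈ ellipticSet D) :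
    ∃ l u, x ∈ Ioo l u ∧ Ioo l u ⊆ ellipticSet D ∧ l ∉ ellipticSet D ∧ u ∉ ellipticSet D := by
  have hcl : IsClosed (ellipticSet D)ᶜ := (isOpen_ellipticSet D).isClosed_compl
  have hlarge : ∀ {F : Filter ℝ}, Tendsto (fun y : ℝ => ‖y‖) F atTop →
      ∀ᶠ y in F, y ∈ (ellipticSet D)ᶜ := by
    intro F hF
    filter_upwards [(D.tendsto_norm_atTop hdeg hF).eventually (eventually_ge_atTop 2)] with y hy
    exact fun h => absurd hy (not_le.2 h)
  obtain ⟨u₀, hu₀, hu₀x⟩ := ((hlarge tendsto_norm_atTop_atTop).and (eventually_ge_atTop x)).exists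
  obtain ⟨l₀, hl₀, hl₀x⟩ := ((hlarge tendsto_abs_atBot_atTop).and (eventually_le_atBot x)).exists
  have hbu : BddBelow ((ellipticSet D)ᶜ ∩ Ici x) := ⟨x, fun y hy => hy.2⟩
  have hbl : BddAbove ((ellipticSet D)ᶜ ∩ Iic x) := ⟨x, fun y hy => hy.2⟩
  have hu := (hcl.inter isClosed_Ici).csInf_mem ⟨u₀, hu₀, hu₀x⟩ hbu
  have hl := (hcl.inter isClosed_Iic).csSup_mem ⟨l₀, hl₀, hl₀x⟩ hbl
  set u := sInf ((ellipticSet D)ᶜ ∩ Ici x)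
  set l := sSup ((ellipticSet D)ᶜ ∩ Iic x)
  have hxu : x < u := lt_of_le_of_ne hu.2 fun h => hu.1 (h ▸ hx)
  have hlx : l < x := lt_of_le_of_ne hl.2 fun h => hl.1 (h.symm ▸ hx)
  refine ⟨l, u, ⟨hlx, hxu⟩, fun y hy => ?_, hl.1, hu.1⟩
  by_contra hyS
  rcases le_total x y with h | h
  · exact absurd (csInf_le hbu ⟨hyS, h⟩) (not_le.2 hy.2)
  · exact absurd (le_csSup hbl ⟨hyS, h⟩) (not_le.2 hy.1)

lemma phase_endpoint {D : ℝ[X]} {l u x : ℝ} (hlu : l < u) (hS : Ioo l u ⊆ ellipticSet D)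
    (hx : x ∈ Icc l u) (hxS : x ∉ ellipticSet D) : phase D x = 0 ∨ phase D x = Real.pi := by
  have h1 : |D.eval x| ≤ 2 := by
    have hcl : IsClosed {y : ℝ | |D.eval y| ≤ 2} := isClosed_le (by fun_prop) continuous_const
    have h2 : closure (Ioo l u) ⊆ {y : ℝ | |D.eval y| ≤ 2} :=
      hcl.closure_subset_iff.2 fun y hy => (show |D.eval y| < 2 from hS hy).le
    rw [closure_Ioo hlu.ne] at h2
    exact h2 hx
  have h2 : |D.eval x| = 2 := le_antisymm h1 (not_lt.1 hxS)
  rcases eq_or_eq_neg_of_abs_eq h2 with h | h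
  · left; simp [phase, h]
  · right; simp [phase, h]

lemma abs_phase_band {D : ℝ[X]} (hD : ∀ E ∈ ellipticSet D, phaseDeriv D E ≠ 0) {l u : ℝ}
    (hlu : l < u) (hS : Ioo l u ⊆ ellipticSet D) (hl : l ∉ ellipticSet D)
    (hu : u ∉ ellipticSet D) : |phase D u - phase D l| = Real.pi := by
  have hlm := left_mem_Icc.2 hlu.le
  have hum := right_mem_Icc.2 hlu.le
  have hne : phase D l ≠ phase D u := fun h => hlu.ne (injOn_phase hD hS hlm hum h)
  have hpi := Real.pi_pos
  rcases phase_endpoint hlu hS hlm hl with h1 | h1 <;>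
    rcases phase_endpoint hlu hS hum hu with h2 | h2 <;> rw [h1, h2] at hne ⊢ <;>
    simp_all [abs_of_pos hpi]

lemma exists_root_in_band {D : ℝ[X]} (hD : ∀ E ∈ ellipticSet D, phaseDeriv D E ≠ 0) {l u : ℝ}
    (hlu : l < u) (hS : Ioo l u ⊆ ellipticSet D) (hl : l ∉ ellipticSet D)
    (hu : u ∉ ellipticSet D) : ∃ y ∈ Ioo l u, D.IsRoot y := by
  have hpi := Real.pi_pos
  have hab := abs_phase_band hD hlu hS hl hu
  have hmem : Real.pi / 2 ∈ phase D '' Ioo l u := by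
    have hc := (continuous_phase D).continuousOn (s := Icc l u)
    rcases phase_endpoint hlu hS (left_mem_Icc.2 hlu.le) hl with h1 | h1 <;>
      rcases phase_endpoint hlu hS (right_mem_Icc.2 hlu.le) hu with h2 | h2 <;>
      rw [h1, h2] at hab
    · simp at hab; linarith
    · exact intermediate_value_Ioo hlu.le hc ⟨by linarith, by linarith⟩
    · exact intermediate_value_Ioo' hlu.le hc ⟨by linarith, by linarith⟩
    · simp at hab; linarith
  obtain ⟨y, hy, hyπ⟩ := hmem
  refine ⟨y, hy, ?_⟩
  have h := two_cos_phase (hS hy)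
  rw [hyπ, Real.cos_pi_div_two, mul_zero] at h
  exact h.symm

/-- The bands are indexed by the zeros of `D`: each contains one since the phase passes `π / 2`, and
only one since the phase is injective. Each band has mass `π / (πp)`. -/
lemma densityOfStates_univ {D : ℝ[X]} (hD : ∀ E ∈ ellipticSet D, phaseDeriv D E ≠ 0) {p : ℕ}
    (hp : 1 ≤ p) (hdeg : D.natDegree = p) (hroots : D.roots.toFinset.card = p) :
    densityOfStates D p univ = 1 := by
  have hpi := Real.pi_pos
  have hpR : (0 : ℝ) < p := by exact_mod_cast hp
  have hdeg' : 0 < D.degree := natDegree_pos_iff_degree_pos.1 (by omega)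
  have hrS : ∀ x ∈ D.roots.toFinset, x ∈ ellipticSet D := by
    intro x hx
    have : D.eval x = 0 := isRoot_of_mem_roots (Multiset.mem_toFinset.1 hx)
    change |D.eval x| < 2
    rw [this]; simp
  choose! l u hx hS hl hu using fun x (hx : x ∈ ellipticSet D) => exists_band hdeg' hx
  have hlu : ∀ x ∈ ellipticSet D, l x < u x := fun x h => (hx x h).1.trans (hx x h).2
  have hone : ∀ x ∈ D.roots.toFinset, densityOfStates D p (Ioo (l x) (u x)) = (p : ENNReal)⁻¹ := by
    intro x hxr
    have hxS := hrS x hxr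
    rw [densityOfStates_Ioo hD (hlu x hxS).le (hS x hxS),
      abs_phase_band hD (hlu x hxS) (hS x hxS) (hl x hxS) (hu x hxS),
      show Real.pi / (Real.pi * p) = (p : ℝ)⁻¹ by field_simp,
      ENNReal.ofReal_inv_of_pos hpR, ENNReal.ofReal_natCast]
  -- The intervals chosen for `x` and for the zero `y` in its band agree, because an endpoint of one
  -- inside the other would be elliptic.
  have hcover : ellipticSet D = ⋃ x ∈ D.roots.toFinset, Ioo (l x) (u x) := by
    refine Subset.antisymm ?_ (iUnion₂_subset fun x hxr => hS x (hrS x hxr))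
    intro x hxS
    obtain ⟨y, hy, hyr⟩ := exists_root_in_band hD (hlu x hxS) (hS x hxS) (hl x hxS) (hu x hxS)
    have hyS := hS x hxS hy
    have hym : y ∈ D.roots.toFinset := by
      rw [Multiset.mem_toFinset, mem_roots (ne_zero_of_degree_gt hdeg')]; exact hyr
    refine mem_iUnion₂.2 ⟨y, hym, ?_, ?_⟩
    · refine lt_of_le_of_lt ?_ (hx x hxS).1
      by_contra! h
      exact hl y hyS (hS x hxS ⟨h, (hx y hyS).1.trans hy.2⟩)
    · refine lt_of_lt_of_le (hx x hxS).2 ?_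
      by_contra! h
      exact hu y hyS (hS x hxS ⟨hy.1.trans (hx y hyS).2, h⟩)
  have hdisj : (D.roots.toFinset : Set ℝ).PairwiseDisjoint fun x => Ioo (l x) (u x) := by
    have key : ∀ x ∈ D.roots.toFinset, ∀ y ∈ D.roots.toFinset, x < y → u x ≤ l y := by
      intro x hxr y hyr hxy
      have hxS := hrS x hxr
      have hyS := hrS y hyr
      have h0 : ∀ z ∈ D.roots.toFinset, phase D z = Real.pi / 2 := fun z hz => by
        have : D.eval z = 0 := isRoot_of_mem_roots (Multiset.mem_toFinset.1 hz)
        rw [phase, this, zero_div, Real.arccos_zero]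
      have hux : u x ≤ y := by
        by_contra! h
        have := injOn_phase hD (hS x hxS) (Ioo_subset_Icc_self (hx x hxS))
          ⟨((hx x hxS).1.trans hxy).le, h.le⟩ ((h0 x hxr).trans (h0 y hyr).symm)
        exact hxy.ne this
      by_contra! h
      exact hu x hxS (hS y hyS ⟨h, hux.trans_lt (hx y hyS).2⟩)
    intro x hxr y hyr hxy
    rcases lt_or_gt_of_ne hxy with h | h
    · refine Set.disjoint_left.2 fun z hz hz' => ?_
      exact (hz.2.trans_le (key x hxr y hyr h)).not_gt hz'.1
    · refine Set.disjoint_left.2 fun z hz hz' => ?_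
      exact (hz'.2.trans_le (key y hyr x hxr h)).not_gt hz.1
  rw [← measure_add_measure_compl (isOpen_ellipticSet D).measurableSet, densityOfStates_compl,
    add_zero, hcover, measure_biUnion_finset hdisj fun _ _ => measurableSet_Ioo,
    Finset.sum_congr rfl hone, Finset.sum_const, hroots, nsmul_eq_mul]
  exact ENNReal.mul_inv_cancel (by simpa using by omega) (ENNReal.natCast_ne_top p)

/-- Real-rootedness is the case `c = 0`; a multiple zero would be a critical point with `|Δ| < 2`.
-/
lemma discPoly_card_roots {a : ℕ → ℝ} (b : ℕ → ℝ) (ha : ∀ n, 1 ≤ n → 0 < a n) {p : ℕ}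
    (hp : 1 ≤ p) : (discPoly a b p).roots.toFinset.card = p := by
  have hs : (discPoly a b p).Splits := by
    simpa using discPoly_sub_C_splits b ha hp (c := 0) (by simp)
  have hd := discPoly_natDegree b hp ha
  have h0 : discPoly a b p ≠ 0 := by
    rintro h; rw [h, natDegree_zero] at hd; omega
  rw [Multiset.toFinset_card_of_nodup, ← hs.natDegree_eq_card_roots, hd]
  rw [Multiset.nodup_iff_count_le_one]
  intro x
  rw [count_roots]
  by_contra! h
  obtain ⟨h1, h2⟩ := (one_lt_rootMultiplicity_iff_isRoot h0).1 h
  exact discPoly_derivative_ne_zero b ha hp (by rw [h1]; simp) h2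

lemma hasSymmDerivAt_densityOfStates {D : ℝ[X]}
    (hD : ∀ E ∈ ellipticSet D, phaseDeriv D E ≠ 0) {p : ℕ} {E : ℝ} (hE : E ∈ ellipticSet D) :
    HasSymmDerivAt (densityOfStates D p) (|phaseDeriv D E| / (Real.pi * p)) E := by
  obtain ⟨δ, hδ, hball⟩ := Metric.isOpen_iff.1 (isOpen_ellipticSet D) E hE
  -- For small `h` the mass of `(E - h, E + h)` is the absolute value of this increment over `πp`.
  have hd : HasDerivAt (fun h => phase D (E + h) - phase D (E - h)) (2 * phaseDeriv D E) 0 := by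
    have h1 : HasDerivAt (fun h => phase D (E + h)) (phaseDeriv D E) 0 :=
      HasDerivAt.comp_const_add E 0 (by simpa using hasDerivAt_phase hE)
    have h2 : HasDerivAt (fun h => phase D (E - h)) (-phaseDeriv D E) 0 :=
      HasDerivAt.comp_const_sub E 0 (by simpa using hasDerivAt_phase hE)
    exact (h1.sub h2).congr_deriv (by ring)
  have hs := (hasDerivAt_iff_tendsto_slope.1 hd).mono_left
    (nhdsWithin_mono (s := Ioi (0 : ℝ)) 0 fun x hx => (mem_Ioi.1 hx).ne')
  have hs' := (hs.abs.div_const (2 * (Real.pi * p)))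
  have e0 : |2 * phaseDeriv D E| / (2 * (Real.pi * p)) = |phaseDeriv D E| / (Real.pi * p) := by
    rw [abs_mul, abs_two, mul_div_mul_left _ _ two_ne_zero]
  rw [e0] at hs'
  refine hs'.congr' ?_
  filter_upwards [Ioo_mem_nhdsGT hδ] with h hh
  have hsub : Ioo (E - h) (E + h) ⊆ ellipticSet D := by
    rw [← Real.ball_eq_Ioo]
    exact (Metric.ball_subset_ball hh.2.le).trans hball
  rw [densityOfStates_Ioo hD (by linarith [hh.1]) hsub, ENNReal.toReal_ofReal (by positivity),
    slope_def_field, add_zero, sub_zero, sub_self, sub_zero, sub_zero, abs_div, abs_of_pos hh.1]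
  have := hh.1
  field_simp

/-! ### Weak convergence of the zero counting measures -/

lemma sum_dirac_apply (s : Multiset ℝ) {A : Set ℝ} (hA : MeasurableSet A) [DecidablePred (· ∈ A)] :
    (s.map fun x => Measure.dirac x).sum A = (s.countP (· ∈ A) : ENNReal) := by
  induction s using Multiset.induction_on with
  | empty => simp
  | cons x s ih =>
    rw [Multiset.map_cons, Multiset.sum_cons, Measure.add_apply, ih, Measure.dirac_apply' _ hA,
      Multiset.countP_cons, Nat.cast_add, add_comm]
    by_cases hx : x ∈ A <;> simp [hx]

lemma card_le_zeroMeasure (a b : ℕ → ℝ) (n : ℕ) {A : Set ℝ} (hA : MeasurableSet A)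
    [DecidablePred (· ∈ A)] :
    (n : ENNReal)⁻¹ * (((orthoPoly a b n).roots.toFinset.filter (· ∈ A)).card : ENNReal) ≤
      zeroMeasure a b n A := by
  rw [zeroMeasure, Measure.smul_apply, smul_eq_mul, sum_dirac_apply _ hA]
  gcongr
  rw [Multiset.countP_eq_card_filter, ← Multiset.toFinset_filter]
  exact Multiset.toFinset_card_le _

lemma isProbabilityMeasure_zeroMeasure {a : ℕ → ℝ} (b : ℕ → ℝ) (ha : ∀ n, 1 ≤ n → 0 < a n)
    {n : ℕ} (hn : n ≠ 0) : IsProbabilityMeasure (zeroMeasure a b n) := by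
  classical
  constructor
  rw [zeroMeasure, Measure.smul_apply, smul_eq_mul, sum_dirac_apply _ MeasurableSet.univ]
  have : Multiset.countP (· ∈ (univ : Set ℝ)) (orthoPoly a b n).roots = n := by
    simp [orthoPoly_card_roots b ha n]
  rw [this]
  exact ENNReal.inv_mul_cancel (by exact_mod_cast hn) (ENNReal.natCast_ne_top n)

namespace PeriodicLimit

variable {p : ℕ} {a₀ b₀ a b : ℕ → ℝ}

lemma phaseDeriv_ne (h : PeriodicLimit p a₀ b₀ a b) :
    ∀ E ∈ ellipticSet (discPoly a₀ b₀ p), phaseDeriv (discPoly a₀ b₀ p) E ≠ 0 :=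
  fun _ hE => phaseDeriv_ne_zero b₀ (fun n _ => h.ha₀ n) h.hp hE

lemma isProbabilityMeasure (h : PeriodicLimit p a₀ b₀ a b) :
    IsProbabilityMeasure (densityOfStates (discPoly a₀ b₀ p) p) :=
  ⟨densityOfStates_univ h.phaseDeriv_ne h.hp (discPoly_natDegree b₀ h.hp fun n _ => h.ha₀ n)
    (discPoly_card_roots b₀ (fun n _ => h.ha₀ n) h.hp)⟩

lemma eventually_le_zeroMeasure (h : PeriodicLimit p a₀ b₀ a b) {s t : ℝ} (hst : s ≤ t)
    (hK : Icc s t ⊆ ellipticSet (discPoly a₀ b₀ p)) {ε : ℝ} (hε : 0 < ε) :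
    ∀ᶠ n : ℕ in atTop, ENNReal.ofReal
      (|phase (discPoly a₀ b₀ p) t - phase (discPoly a₀ b₀ p) s| / (Real.pi * p) - ε) ≤
      zeroMeasure a b n (Ioo s t) := by
  classical
  filter_upwards [h.count hst hK hε, eventually_gt_atTop 0] with n hn hn0
  refine le_trans ?_ (card_le_zeroMeasure a b n measurableSet_Ioo)
  have hnR : (0 : ℝ) < n := by exact_mod_cast hn0
  rw [mul_comm, ← le_div_iff₀ hnR] at hn
  refine (ENNReal.ofReal_le_ofReal hn).trans ?_
  rw [ENNReal.ofReal_div_of_pos hnR, ENNReal.ofReal_natCast, ENNReal.ofReal_natCast,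
    ENNReal.div_eq_inv_mul]

/-- Cover `K` by finitely many grid cells inside `U`. The cells bound the mass of `K` from above,
their disjoint interiors bound the zeros in `U` from below, and the counting lemma compares the two
up to `ε` per cell. -/
lemma compact_le_liminf (h : PeriodicLimit p a₀ b₀ a b) {K U : Set ℝ} (hK : IsCompact K)
    (hU : IsOpen U) (hKU : K ⊆ U) (hUS : U ⊆ ellipticSet (discPoly a₀ b₀ p)) :
    densityOfStates (discPoly a₀ b₀ p) p K ≤
      liminf (fun n => zeroMeasure a b n U) atTop := by
  classical
  set D := discPoly a₀ b₀ p with hDdef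
  have hD := h.phaseDeriv_ne
  obtain ⟨δ, hδ, hthick⟩ := hK.exists_thickening_subset_open hU hKU
  -- With mesh below `δ`, every closed cell meeting `K` stays in the `δ`-thickening, hence in `U`.
  set w := δ / 2 with hw
  have hw0 : 0 < w := half_pos hδ
  obtain ⟨R, hR⟩ := hK.isBounded.exists_norm_le
  set J : Finset ℤ := (Finset.Icc ⌊-R / w⌋ ⌊R / w⌋).filter
    fun j => (K ∩ Ico (j * w) ((j + 1) * w)).Nonempty with hJ
  have hle : ∀ j : ℤ, (j : ℝ) * w ≤ (j + 1) * w := fun j => by nlinarith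
  have hsub : ∀ j ∈ J, Icc ((j : ℝ) * w) ((j + 1) * w) ⊆ U := by
    intro j hj x hx
    obtain ⟨y, hyK, hy⟩ := (Finset.mem_filter.1 hj).2
    refine hthick (Metric.mem_thickening_iff.2 ⟨y, hyK, ?_⟩)
    rw [Real.dist_eq, abs_lt]
    constructor <;> nlinarith [hx.1, hx.2, hy.1, hy.2]
  have hcover : K ⊆ ⋃ j ∈ J, Ico ((j : ℝ) * w) ((j + 1) * w) := by
    intro x hx
    have hxR := abs_le.1 (hR x hx)
    have hmem : x ∈ Ico ((⌊x / w⌋ : ℝ) * w) ((⌊x / w⌋ + 1) * w) :=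
      ⟨(le_div_iff₀ hw0).1 (Int.floor_le _), (div_lt_iff₀ hw0).1 (Int.lt_floor_add_one _)⟩
    refine mem_iUnion₂.2 ⟨⌊x / w⌋, Finset.mem_filter.2 ⟨Finset.mem_Icc.2 ⟨?_, ?_⟩, x, hx, hmem⟩,
      hmem⟩
    · exact Int.floor_le_floor (div_le_div_of_nonneg_right hxR.1 hw0.le)
    · exact Int.floor_le_floor (div_le_div_of_nonneg_right hxR.2 hw0.le)
  set c : ℤ → ℝ := fun j => |phase D ((j + 1) * w) - phase D (j * w)| / (Real.pi * p) with hc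
  have hcell : ∀ j ∈ J, densityOfStates D p (Ico ((j : ℝ) * w) ((j + 1) * w)) =
      ENNReal.ofReal (c j) := by
    intro j hj
    have hS := (hsub j hj).trans hUS
    rw [← densityOfStates_Ioo hD (hle j) (Ioo_subset_Icc_self.trans hS),
      densityOfStates_apply measurableSet_Ico (Ico_subset_Icc_self.trans hS),
      densityOfStates_apply measurableSet_Ioo (Ioo_subset_Icc_self.trans hS)]
    exact setLIntegral_congr Ioo_ae_eq_Ico.symm
  have hupper : densityOfStates D p K ≤ ∑ j ∈ J, ENNReal.ofReal (c j) := by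
    refine (measure_mono hcover).trans ((measure_biUnion_finset_le _ _).trans ?_)
    exact (Finset.sum_congr rfl hcell).le
  have hdisj : (J : Set ℤ).PairwiseDisjoint fun j : ℤ => Ioo ((j : ℝ) * w) ((j + 1) * w) := by
    have key : ∀ i j : ℤ, i < j → Disjoint (Ioo ((i : ℝ) * w) ((i + 1) * w))
        (Ioo ((j : ℝ) * w) ((j + 1) * w)) := by
      intro i j hij
      refine Set.disjoint_left.2 fun x hx hx' => ?_
      have h1 : ((i : ℝ) + 1) ≤ j := by exact_mod_cast hij
      nlinarith [hx.2, hx'.1]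
    intro i _ j _ hij
    rcases lt_or_gt_of_ne hij with h | h
    · exact key i j h
    · exact (key j i h).symm
  have hlower : ∀ ε > 0, ∑ j ∈ J, ENNReal.ofReal (c j - ε) ≤
      liminf (fun n => zeroMeasure a b n U) atTop := by
    intro ε hε
    refine le_liminf_of_le (by isBoundedDefault) ?_
    have hev : ∀ᶠ n in atTop, ∀ j ∈ J, ENNReal.ofReal (c j - ε) ≤
        zeroMeasure a b n (Ioo ((j : ℝ) * w) ((j + 1) * w)) :=
      (Finset.eventually_all _).2 fun j hj =>
        h.eventually_le_zeroMeasure (hle j) ((hsub j hj).trans hUS) hε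
    filter_upwards [hev] with n hn
    calc ∑ j ∈ J, ENNReal.ofReal (c j - ε)
        ≤ ∑ j ∈ J, zeroMeasure a b n (Ioo ((j : ℝ) * w) ((j + 1) * w)) := Finset.sum_le_sum hn
      _ = zeroMeasure a b n (⋃ j ∈ J, Ioo ((j : ℝ) * w) ((j + 1) * w)) :=
        (measure_biUnion_finset hdisj fun _ _ => measurableSet_Ioo).symm
      _ ≤ zeroMeasure a b n U :=
        measure_mono (iUnion₂_subset fun j hj => Ioo_subset_Icc_self.trans (hsub j hj))
  refine hupper.trans ?_
  have hlim : Tendsto (fun ε : ℝ => ∑ j ∈ J, ENNReal.ofReal (c j - ε)) (𝓝[>] 0)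
      (𝓝 (∑ j ∈ J, ENNReal.ofReal (c j))) := by
    refine Tendsto.mono_left (tendsto_finsetSum _ fun j _ => ?_) nhdsWithin_le_nhds
    have : Tendsto (fun ε : ℝ => c j - ε) (𝓝 0) (𝓝 (c j - 0)) :=
      tendsto_const_nhds.sub tendsto_id
    rw [sub_zero] at this
    exact ENNReal.tendsto_ofReal this
  exact le_of_tendsto hlim (eventually_nhdsWithin_of_forall hlower)

lemma isDensityOfStates (h : PeriodicLimit p a₀ b₀ a b) :
    IsDensityOfStates a b (densityOfStates (discPoly a₀ b₀ p) p) := by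
  have hprob := h.isProbabilityMeasure
  refine ⟨hprob, ?_⟩
  set D := discPoly a₀ b₀ p with hDdef
  set μ : ProbabilityMeasure ℝ := ⟨densityOfStates D p, hprob⟩ with hμ
  -- Shifted by one, since `p_0` has no zeros and index `0` gives no probability measure.
  set μs : ℕ → ProbabilityMeasure ℝ := fun n =>
    ⟨zeroMeasure a b (n + 1), isProbabilityMeasure_zeroMeasure b h.ha n.succ_ne_zero⟩ with hμs
  have hconv : Tendsto μs atTop (𝓝 μ) := by
    -- Portmanteau for probability measures: lower bounds on open sets suffice. Inner regularity
    -- reduces them to compact subsets of the bands.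
    refine tendsto_of_forall_isOpen_le_liminf' fun G hG => ?_
    change densityOfStates D p G ≤ liminf (fun n => zeroMeasure a b (n + 1) G) atTop
    have hGS : densityOfStates D p G = densityOfStates D p (G ∩ ellipticSet D) := by
      rw [← measure_inter_add_sdiff G (isOpen_ellipticSet D).measurableSet]
      rw [measure_mono_null (sdiff_subset_compl _ _) densityOfStates_compl, add_zero]
    have hshift : liminf (fun n => zeroMeasure a b (n + 1) G) atTop =
        liminf (fun n => zeroMeasure a b n G) atTop :=
      Filter.liminf_nat_add (fun n => zeroMeasure a b n G) 1
    have hV := hG.inter (isOpen_ellipticSet D)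
    rw [hGS, hshift, hV.measure_eq_iSup_isCompact]
    refine iSup₂_le fun K hKV => iSup_le fun hK => ?_
    refine (h.compact_le_liminf hK hV hKV inter_subset_right).trans ?_
    exact liminf_le_liminf (Eventually.of_forall fun n => measure_mono inter_subset_left)
  intro f
  have := ProbabilityMeasure.tendsto_iff_forall_integral_tendsto.1 hconv f
  exact (tendsto_add_atTop_iff_nat 1).1 this

end PeriodicLimit

lemma densityOfStates_restrict {D : Polynomial ℝ} {p : ℕ} {α β : ℝ}
    (hK : Icc α β ⊆ ellipticSet D) :
    (densityOfStates D p).restrict (Icc α β) = (volume.restrict (Icc α β)).withDensity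
      fun E => ENNReal.ofReal (|phaseDeriv D E| / (Real.pi * p)) := by
  rw [densityOfStates, restrict_withDensity measurableSet_Icc,
    Measure.restrict_restrict measurableSet_Icc, inter_eq_self_of_subset_left hK]

lemma PeriodicLimit.uniformClock {p : ℕ} {a₀ b₀ a b : ℕ → ℝ} (h : PeriodicLimit p a₀ b₀ a b)
    {α β : ℝ} (hαβ : α ≤ β) (hK : Icc α β ⊆ ellipticSet (discPoly a₀ b₀ p)) :
    UniformClock a b (densityOfStates (discPoly a₀ b₀ p) p) α β := by
  have hpR : (p : ℝ) ≠ 0 := by have := h.hp; exact_mod_cast (by omega : p ≠ 0)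
  refine ⟨fun E => |phaseDeriv (discPoly a₀ b₀ p) E| / (Real.pi * p),
    fun E hE => hasSymmDerivAt_densityOfStates h.phaseDeriv_ne (hK hE),
    (((continuousOn_phaseDeriv _).mono hK).abs).div_const _, fun E hE => ?_,
    fun ε hε => h.clock hαβ hK hε⟩
  exact div_ne_zero (abs_ne_zero.2 (h.phaseDeriv_ne E (hK hE))) (mul_ne_zero Real.pi_ne_zero hpR)

end JacobiClock

/-! ### The theorem -/

theorem theorem3p6 (p : ℕ) (hp : 1 ≤ p) (a₀ b₀ a b : ℕ → ℝ)
    (ha₀ : ∀ n, 0 < a₀ n) (ha : ∀ n, 1 ≤ n → 0 < a n)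
    (ha₀p : ∀ n, a₀ (n + p) = a₀ n) (hb₀p : ∀ n, b₀ (n + p) = b₀ n)
    (hlim : Tendsto (fun n => |a n - a₀ n| + |b n - b₀ n|) atTop (𝓝 0))
    (hsum : Summable (fun n : ℕ =>
      |a (n + 1 + p) - a (n + 1)| + |b (n + 1 + p) - b (n + 1)|)) :
    ∃ ν : Measure ℝ, JacobiClock.IsDensityOfStates a b ν ∧
      (∃ γ : ℝ → ℝ, JacobiClock.IsFloquetPhase a₀ b₀ p γ) ∧
      ∀ γ : ℝ → ℝ, JacobiClock.IsFloquetPhase a₀ b₀ p γ →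
        ∀ α β : ℝ, α ≤ β → Icc α β ⊆ JacobiClock.bandInterior a₀ b₀ p →
          JacobiClock.UniformClock a b ν α β ∧
          (∀ E ∈ Icc α β,
            JacobiClock.HasSymmDerivAt ν (-(1 / (Real.pi * p)) * deriv γ E) E) ∧
          ν.restrict (Icc α β) =
            (volume.restrict (Icc α β)).withDensity
              (fun E => ENNReal.ofReal (-(1 / (Real.pi * p)) * deriv γ E)) := by
  have h : JacobiClock.PeriodicLimit p a₀ b₀ a b := ⟨hp, ha₀, ha, ha₀p, hb₀p, hlim, hsum⟩
  refine ⟨JacobiClock.densityOfStates (JacobiClock.discPoly a₀ b₀ p) p, h.isDensityOfStates,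
    JacobiClock.exists_isFloquetPhase hp ha₀ ha₀p hb₀p, ?_⟩
  intro γ hγ α β hαβ hK
  rw [JacobiClock.bandInterior_eq ha₀ ha₀p] at hK
  have hρ : ∀ E ∈ Icc α β, -(1 / (Real.pi * p)) * deriv γ E =
      |JacobiClock.phaseDeriv (JacobiClock.discPoly a₀ b₀ p) E| / (Real.pi * p) := by
    intro E hE
    rw [hγ.deriv_eq ha₀ ha₀p (hK hE)]
    ring
  refine ⟨h.uniformClock hαβ hK, fun E hE => ?_, ?_⟩
  · rw [hρ E hE]
    exact JacobiClock.hasSymmDerivAt_densityOfStates h.phaseDeriv_ne (hK hE)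
  · rw [JacobiClock.densityOfStates_restrict hK]
    refine withDensity_congr_ae ?_
    filter_upwards [ae_restrict_mem measurableSet_Icc] with E hE
    rw [hρ E hE]
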